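/- For every $n \ge 0$ there is a constant $C(n)$, depending only on $n$, such that the following holds. Let $\mathbf{F}$ be a finite field of characteristic $p$, let $L = \mathrm{GL}_n(\mathbf{F})$, and let $N \trianglelefteq \Gamma \le L$ be subgroups such that the section $\Sigma = \Gamma/N$ is soluble. Let $O_p(\Sigma)$ denote the largest normal $p$-subgroup of $\Sigma$, and let $R = N_L(\Gamma) \cap N_L(N)$, which acts on $\Sigma$ by conjugation. Then $\Sigma$ has a characteristic subgroup $\Sigma_0 = \Gamma_0/N$ (with $N \le \Gamma_0 \le \Gamma$) such that (a) $[\Sigma : \Sigma_0] \le C(n)$ and $O_p(\Sigma) \le \Sigma_0$; (b) $\Sigma_0$ is trigonalizable, that is, there is a subgroup $B \le L$ that is conjugate in $\mathrm{GL}_n(\mathbf{E})$, for some extension field $\mathbf{E}$ of $\mathbf{F}$, to a group of upper-triangular matrices, and such that $B \cap \Gamma_0$ maps onto $\Sigma_0 = \Gamma_0/N$; (c) $[R : C_R(\Sigma_0/O_p(\Sigma))] \le n!$, where $C_R(\Sigma_0/O_p(\Sigma))$ is the set of elements of $R$ that act trivially by conjugation on $\Sigma_0/O_p(\Sigma)$.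 -/

import Mathlib

universe u

/-- The `p`-core `O_p(G)`: the subgroup generated by all normal `p`-subgroups of `G`, which for a
finite group is the largest normal `p`-subgroup. -/
def pCore (p : ℕ) (G : Type*) [Group G] : Subgroup G :=
  sSup {H : Subgroup G | H.Normal ∧ IsPGroup p H}

/-- The underlying quotient `H / N` of a section of `G`; used when `N ≤ H` and `N` is normal
in `H`. -/
abbrev SectionQuot {G : Type*} [Group G] (H N : Subgroup G) : Type _ :=
  H ⧸ N.subgroupOf H

/-- The trace `tr(A, H / N)`: the projection of `A ∩ H` to `H / N`. -/
def sectionTrace {G : Type*} [Group G] (A : Set G) (H N : Subgroup G) : Set (SectionQuot H N) :=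
  (fun h : H => (QuotientGroup.mk h : SectionQuot H N)) '' {h : H | (h : G) ∈ A}

/-- The preimage in `H ≤ G` of a subgroup `K` of the section `H / N`. Thus `K` is the section
`sectionPreimage H N K / N` of `G`. -/
def sectionPreimage {G : Type*} [Group G] (H N : Subgroup G) [(N.subgroupOf H).Normal]
    (K : Subgroup (SectionQuot H N)) : Subgroup G :=
  (K.comap (QuotientGroup.mk' (N.subgroupOf H))).map H.subtype

/-- The normalizer `N_G(H / N) = N_G(H) ∩ N_G(N)` of a section. -/
def sectionNormalizer {G : Type*} [Group G] (H N : Subgroup G) : Subgroup G :=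
  Subgroup.normalizer (H : Set G) ⊓ Subgroup.normalizer (N : Set G)

/-- The centralizer `C_G(H / N)` of a section: the elements `g` of its normalizer such that
conjugation by `g` is trivial on `H / N`, i.e. `g h g⁻¹ N = h N` for all `h ∈ H`. -/
def sectionCentralizer {G : Type*} [Group G] (H N : Subgroup G) : Subgroup G where
  carrier := {g | g ∈ sectionNormalizer H N ∧ ∀ h ∈ H, h⁻¹ * (g * h * g⁻¹) ∈ N}
  one_mem' := ⟨one_mem _, fun h _ => by simp⟩
  mul_mem' := by
    rintro a b ⟨ha, ha'⟩ ⟨hb, hb'⟩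
    refine ⟨mul_mem ha hb, fun h hh => ?_⟩
    have h1 := (Subgroup.mem_normalizer_iff.1 ha.2 _).1 (hb' h hh)
    have h2 := mul_mem (ha' h hh) h1
    convert h2 using 1
    group
  inv_mem' := by
    rintro a ⟨ha, ha'⟩
    refine ⟨inv_mem ha, fun h hh => ?_⟩
    have h1 := (Subgroup.mem_normalizer_iff.1 (inv_mem ha).1 h).1 hh
    have h2 := inv_mem (ha' _ h1)
    convert h2 using 1
    group

/-- A subgroup of `GL_n(F)` is trigonalizable if over some extension field `E` of `F` it is
conjugate in `GL_n(E)` to a group of upper-triangular matrices. -/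
def IsTrigonalizable {n : ℕ} {F : Type u} [Field F]
    (B : Subgroup (Matrix.GeneralLinearGroup (Fin n) F)) : Prop :=
  ∃ (E : Type u) (_ : Field E) (_ : Algebra F E) (x : Matrix.GeneralLinearGroup (Fin n) E),
    ∀ b ∈ B, Matrix.BlockTriangular
      (x * Matrix.GeneralLinearGroup.map (algebraMap F E) b * x⁻¹ :
        Matrix.GeneralLinearGroup (Fin n) E).val id

/-- A section `H / N` of `GL_n(F)` is trigonalizable if it is the trace of a trigonalizable
subgroup. -/
def IsTrigonalizableSection {n : ℕ} {F : Type u} [Field F]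
    (H N : Subgroup (Matrix.GeneralLinearGroup (Fin n) F)) : Prop :=
  ∃ B : Subgroup (Matrix.GeneralLinearGroup (Fin n) F),
    IsTrigonalizable B ∧ sectionTrace (B : Set _) H N = Set.univ

/-! ### Counting cosets by joint eigenvectors -/

section JointEigenvectors

variable {K V ι κ : Type*} [Field K] [AddCommGroup V] [Module K V]

/-! Let `P` be the preimage of `O_p(Σ)` in `Γ` and `Q = Σ / O_p(Σ)`, so that `Q` has trivial
`p`-core. The group `Γ` need not be soluble, so Mal'cev's theorem is applied to a soluble subgroup
covering `Q`. By the Frattini argument the normalizer in `R` of a Sylow `p`-subgroup `S` of `P`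
supplements `P` in `R`. In a minimal supplement `X` inside it, `X ∩ P` lies in the Frattini subgroup
of `X`, hence is nilpotent. Therefore `D = X ∩ Γ` is soluble and maps onto `Q`.

Mal'cev's theorem gives a normal subgroup `U` of `D`, of bounded index, that is upper triangular
over the algebraic closure `K`. The elements of `U` with diagonal 1 form a normal `p`-subgroup of
`U`, which dies in `Q`. So the map from `U` to `Q` factors through a finite subgroup of `(Kˣ) ^ n`,
where `m`-th powers have index at most `m ^ n`. With `m` a multiple of `[D : U]`, the subgroup `Σ₀ =
O_p(Σ) Σ ^ m` has bounded index, and `V = D ^ m ≤ U` covers `Σ₀ / O_p(Σ)`.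

For (b), `S` covers the `p`-group `P / N`, so `B = S V` covers `Σ₀`; it is trigonalizable because a
`p`-group in characteristic `p` has fixed vectors and `V` normalizes `S`. For (c), `X` permutes the
at most `n` characters of the algebra spanned by `V`. An element fixing all of them moves each `v ∈
V` by a factor with diagonal 1, which lies in `P`. As `P` centralizes `Γ₀ / P` and `X P = R`, the
bound is `n!`.

Mal'cev's theorem itself is by induction on the dimension, from `exists_invariant_of_isSolvable`: a
soluble nonscalar group has a subgroup of small index with an invariant subspace. -/

/-- Joint eigenvectors with distinct systems of eigenvalues are linearly independent. -/
theorem linearIndependent_of_joint_eigenvectors (T : ι → Module.End K V) (v : κ → V)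
    (χ : κ → ι → K) (hv : ∀ k, v k ≠ 0) (hT : ∀ k i, T i (v k) = χ k i • v k)
    (hχ : Function.Injective χ) : LinearIndependent K v := by
  classical
  -- Eigenvalue systems extend to characters of the free monoid on `ι`, so that Dedekind's
  -- independence of characters applies.
  have hlift : ∀ k (w : FreeMonoid ι),
      FreeMonoid.lift T w (v k) = FreeMonoid.lift (χ k) w • v k := by
    intro k w
    induction w using FreeMonoid.inductionOn with
    | one => simp
    | of i => simp [hT]
    | mul a b ha hb => simp [ha, hb, smul_smul, mul_comm]
  have hdist : Function.Injective fun k => FreeMonoid.lift (χ k) :=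
    fun a b h => hχ (FreeMonoid.lift.injective h)
  have hind := (linearIndependent_monoidHom (FreeMonoid ι) K).comp _ hdist
  rw [linearIndependent_iff'] at hind ⊢
  intro s c hc k hk
  -- A functional not vanishing at `v k` turns a relation among vectors into one among characters.
  obtain ⟨φ, hφ⟩ : ∃ φ : Module.Dual K V, φ (v k) ≠ 0 := by
    by_contra! h
    exact hv k ((Module.forall_dual_apply_eq_zero_iff K (v k)).1 h)
  have := hind s (fun j => c j * φ (v j)) (by
    funext w
    have h1 := congrArg φ (congrArg (FreeMonoid.lift T w) hc)
    simp only [map_sum, map_smul, hlift, map_zero, smul_eq_mul] at h1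
    simp only [Finset.sum_apply, Function.comp, Pi.smul_apply, smul_eq_mul, Pi.zero_apply]
    rw [← h1]
    exact Finset.sum_congr rfl fun j _ => by ring) k hk
  exact (mul_eq_zero.1 this).resolve_right hφ

/-- A subgroup has index at most `dim V` as soon as the elements of the group index joint
eigenvectors whose eigenvalues separate the cosets of the subgroup. -/
theorem Subgroup.index_le_finrank_of_joint_eigenvectors {G : Type*} [Group G]
    [FiniteDimensional K V] (H : Subgroup G) (T : ι → Module.End K V) (v : G → V)
    (χ : G → ι → K) (hv : ∀ g, v g ≠ 0) (hT : ∀ g i, T i (v g) = χ g i • v g)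
    (hχ : ∀ a b, χ a = χ b → a⁻¹ * b ∈ H) :
    H.index ≠ 0 ∧ H.index ≤ Module.finrank K V := by
  have hind : LinearIndependent K fun q : G ⧸ H => v q.out :=
    linearIndependent_of_joint_eigenvectors T _ (fun q => χ q.out) (fun q => hv _)
      (fun q i => hT _ i) fun a b h => by
        rw [← QuotientGroup.out_eq' a, ← QuotientGroup.out_eq' b]
        exact QuotientGroup.eq.2 (hχ _ _ h)
  have hfin : Finite (G ⧸ H) := hind.finite
  have := Fintype.ofFinite (G ⧸ H)
  refine ⟨Subgroup.index_ne_zero_of_finite, ?_⟩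
  rw [Subgroup.index, Nat.card_eq_fintype_card]
  exact hind.fintype_card_le_finrank

end JointEigenvectors

/-! ### Invariant subspaces for soluble linear groups -/

open scoped commutatorElement

namespace Representation

variable {K G V : Type*} [Field K] [Group G] [AddCommGroup V] [Module K V]

/-- The subgroup of the elements that act as scalars. -/
def scalarSubgroup (ρ : Representation K G V) : Subgroup G where
  carrier := {g | ∃ c : K, ρ g = c • 1}
  one_mem' := ⟨1, by simp⟩
  mul_mem' := by
    rintro a b ⟨c, hc⟩ ⟨d, hd⟩
    exact ⟨c * d, by rw [map_mul, hc, hd, smul_mul_smul_comm, one_mul]⟩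
  inv_mem' := by
    rintro a ⟨c, hc⟩
    have h1 : ρ a⁻¹ * ρ a = 1 := by rw [← map_mul]; simp
    rw [hc, mul_smul_comm, mul_one] at h1
    refine ⟨c⁻¹, ?_⟩
    rcases eq_or_ne c 0 with rfl | h0
    · rw [zero_smul] at h1
      rw [← mul_one (ρ a⁻¹), ← h1]; simp
    · rw [← h1, smul_smul, inv_mul_cancel₀ h0, one_smul]

theorem apply_inv_mul_self (ρ : Representation K G V) (g : G) : ρ g⁻¹ * ρ g = 1 := by
  rw [← map_mul]; simp

theorem apply_ne_zero [Nontrivial V] (ρ : Representation K G V) (g : G) : ρ g ≠ 0 := by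
  intro h
  have := ρ.apply_inv_mul_self g
  rw [h, mul_zero] at this
  exact zero_ne_one this

theorem apply_vec_ne_zero (ρ : Representation K G V) (g : G) {v : V} (hv : v ≠ 0) :
    ρ g v ≠ 0 := by
  intro h
  have := congrArg (fun f : Module.End K V => f v) (ρ.apply_inv_mul_self g)
  simp only [Module.End.mul_apply, h, map_zero, Module.End.one_apply] at this
  exact hv this.symm

/-- A commuting family of operators on a nonzero space over an algebraically closed field has a
joint eigenvector. -/
theorem _root_.Module.End.exists_joint_eigenvector {ι : Type*} [IsAlgClosed K]
    [FiniteDimensional K V] [Nontrivial V] (T : ι → Module.End K V)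
    (hT : ∀ i j, Commute (T i) (T j)) :
    ∃ v : V, v ≠ 0 ∧ ∀ i, ∃ c : K, T i v = c • v := by
  -- A minimal nonzero subspace invariant under all `T i` lies in one eigenspace of each of them,
  -- since commuting operators preserve each other's eigenspaces.
  let P : Set (Submodule K V) := {W | W ≠ ⊥ ∧ ∀ i, ∀ w ∈ W, T i w ∈ W}
  have hP : P.Nonempty := ⟨⊤, top_ne_bot, fun _ _ _ => Submodule.mem_top⟩
  obtain ⟨W, ⟨hW0, hWT⟩, hmin⟩ := WellFounded.has_min
    (wellFounded_lt (α := Submodule K V)) P hP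
  obtain ⟨v, hv, hv0⟩ := Submodule.exists_mem_ne_zero_of_ne_bot hW0
  refine ⟨v, hv0, fun i => ?_⟩
  have : Nontrivial W := Submodule.nontrivial_iff_ne_bot.2 hW0
  obtain ⟨c, hc⟩ := Module.End.exists_eigenvalue ((T i).restrict (hWT i))
  obtain ⟨w, hw⟩ := hc.exists_hasEigenvector
  have hwc : T i w = c • (w : V) := congrArg Subtype.val hw.apply_eq_smul
  have hle : W ≤ (T i).eigenspace c := by
    by_contra hn
    refine hmin (W ⊓ (T i).eigenspace c) ⟨?_, ?_⟩ (inf_lt_left.2 hn)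
    · intro h
      have : (w : V) ∈ W ⊓ (T i).eigenspace c :=
        ⟨w.2, Module.End.mem_eigenspace_iff.2 hwc⟩
      rw [h, Submodule.mem_bot] at this
      exact hw.2 (Subtype.ext this)
    · rintro j x ⟨hx, hxe⟩
      refine ⟨hWT j x hx, Module.End.mem_eigenspace_iff.2 ?_⟩
      have h2 := Module.End.mem_eigenspace_iff.1 hxe
      rw [← Module.End.mul_apply, (hT i j).eq, Module.End.mul_apply, h2, map_smul]
  exact ⟨c, Module.End.mem_eigenspace_iff.1 (hle hv)⟩

variable [IsAlgClosed K] [FiniteDimensional K V] [Nontrivial V]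

/-- If a normal subgroup acts by commuting operators that are not all scalar, then a subgroup of
index at most `dim V` stabilizes a proper nonzero subspace. -/
theorem exists_invariant_of_normal_commuting (ρ : Representation K G V) (A : Subgroup G)
    [hA : A.Normal] (hcomm : ∀ a ∈ A, ∀ b ∈ A, Commute (ρ a) (ρ b))
    (hns : ¬ A ≤ ρ.scalarSubgroup) :
    ∃ (H : Subgroup G) (W : Submodule K V), H.index ≠ 0 ∧ H.index ≤ Module.finrank K V ∧
      W ≠ ⊥ ∧ W ≠ ⊤ ∧ ∀ h ∈ H, W ≤ W.comap (ρ h) := by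
  obtain ⟨w, hw0, hw⟩ := Module.End.exists_joint_eigenvector (fun a : A => ρ a)
    (fun a b => hcomm a a.2 b b.2)
  choose χ hχ using hw
  have conj_mem : ∀ (g : G) (a : A), g⁻¹ * a * g ∈ A := fun g a => by
    simpa using hA.conj_mem a a.2 g⁻¹
  let act : G → A → A := fun g a => ⟨g⁻¹ * a * g, conj_mem g a⟩
  have act_mul : ∀ g h a, act (g * h) a = act h (act g a) := fun g h a => by
    apply Subtype.ext; simp [act, mul_assoc]
  have act_one : ∀ a, act 1 a = a := fun a => by apply Subtype.ext; simp [act]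
  have hgw : ∀ (g : G) (a : A) (v : V), ρ a (ρ g v) = ρ g (ρ (act g a) v) := by
    intro g a v
    rw [← Module.End.mul_apply, ← Module.End.mul_apply, ← map_mul, ← map_mul]
    congr 2; simp [act, mul_assoc]
  -- The stabilizer of the character `χ`. The translates `ρ g w` are joint eigenvectors for the
  -- conjugates of `χ`, so the orbit of `χ` has at most `dim V` elements.
  let H : Subgroup G :=
    { carrier := {g | ∀ a, χ (act g a) = χ a}
      one_mem' := fun a => by rw [act_one]
      mul_mem' := fun {g h} hg hh a => by rw [act_mul, hh, hg]
      inv_mem' := fun {g} hg a => by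
        rw [← hg (act g⁻¹ a), ← act_mul, inv_mul_cancel, act_one] }
  let W : Submodule K V := ⨅ a : A, Module.End.eigenspace (ρ a) (χ a)
  have hmemW : ∀ v, v ∈ W ↔ ∀ a : A, ρ a v = χ a • v := fun v => by
    simp [W, Submodule.mem_iInf]
  have hidx := H.index_le_finrank_of_joint_eigenvectors (fun a : A => ρ a) (fun g => ρ g w)
    (fun g a => χ (act g a)) (fun g => ρ.apply_vec_ne_zero g hw0)
    (fun g a => by rw [hgw, hχ, map_smul])
    (fun g h hgh a => by
      have := congrFun hgh (act g⁻¹ a)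
      simp only [← act_mul, inv_mul_cancel, act_one] at this
      exact this.symm)
  refine ⟨H, W, hidx.1, hidx.2, ?_, ?_, ?_⟩
  · intro h
    have : w ∈ W := (hmemW w).2 hχ
    rw [h] at this
    exact hw0 (by simpa using this)
  · intro h
    refine hns fun a ha => ⟨χ ⟨a, ha⟩, LinearMap.ext fun v => ?_⟩
    have : v ∈ W := h ▸ Submodule.mem_top
    simpa using (hmemW v).1 this ⟨a, ha⟩
  · intro h hh v hv
    rw [Submodule.mem_comap, hmemW]
    intro a
    rw [hgw, (hmemW v).1 hv, hh a, map_smul]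

/-- If a normal subgroup acts non-scalarly but with scalar commutators, and its elements that
commute with all of it act as scalars, then a subgroup of index at most `(dim V) ^ 3` stabilizes a
proper nonzero subspace. -/
theorem exists_invariant_of_normal_scalar_commutator (ρ : Representation K G V) (B : Subgroup G)
    [hB : B.Normal] (hcomm : ⁅B, B⁆ ≤ ρ.scalarSubgroup) (hns : ¬ B ≤ ρ.scalarSubgroup)
    (hcent : ∀ z ∈ B, (∀ b ∈ B, Commute (ρ z) (ρ b)) → z ∈ ρ.scalarSubgroup) :
    ∃ (H : Subgroup G) (W : Submodule K V), H.index ≠ 0 ∧ H.index ≤ Module.finrank K V ^ 3 ∧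
      W ≠ ⊥ ∧ W ≠ ⊤ ∧ ∀ h ∈ H, W ≤ W.comap (ρ h) := by
  obtain ⟨b, hb, hbs⟩ := SetLike.not_le_iff_exists.1 hns
  -- `c g x` is the scalar by which the commutator `[x, g b g⁻¹]` acts
  have hc : ∀ (g : G) (x : B), ∃ c : K,
      ρ (x * (g * b * g⁻¹) * (x : G)⁻¹) = c • ρ (g * b * g⁻¹) := by
    intro g x
    obtain ⟨c, hc⟩ := hcomm (Subgroup.commutator_mem_commutator x.2 (hB.conj_mem b hb g))
    refine ⟨c, ?_⟩
    have : (x * (g * b * g⁻¹) * (x : G)⁻¹) = ⁅(x : G), g * b * g⁻¹⁆ * (g * b * g⁻¹) := by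
      simp only [commutatorElement_def]; group
    rw [this, map_mul, hc, smul_mul_assoc, one_mul]
  choose c hc using hc
  -- The stabilizer of the line spanned by `ρ b` under conjugation.
  let H : Subgroup G :=
    { carrier := {g | ∃ l : K, ρ (g * b * g⁻¹) = l • ρ b}
      one_mem' := ⟨1, by simp⟩
      mul_mem' := by
        rintro g h ⟨l, hl⟩ ⟨l', hl'⟩
        refine ⟨l' * l, ?_⟩
        have : g * h * b * (g * h)⁻¹ = g * (h * b * h⁻¹) * g⁻¹ := by group
        rw [this, map_mul, map_mul, hl', mul_smul_comm, smul_mul_assoc, ← map_mul, ← map_mul, hl,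
          smul_smul]
      inv_mem' := by
        rintro g ⟨l, hl⟩
        have h1 : ρ b = l • ρ (g⁻¹ * b * g⁻¹⁻¹) := by
          have : b = g⁻¹ * (g * b * g⁻¹) * g := by group
          conv_lhs => rw [this]
          rw [map_mul, map_mul, hl, mul_smul_comm, smul_mul_assoc, ← map_mul, ← map_mul, inv_inv]
        refine ⟨l⁻¹, ?_⟩
        rcases eq_or_ne l 0 with rfl | h0
        · rw [zero_smul] at h1
          exact absurd h1 (ρ.apply_ne_zero b)
        · rw [h1, smul_smul, inv_mul_cancel₀ h0, one_smul] }
  -- `B` acts on `End V` by conjugation, with the conjugates of `ρ b` as joint eigenvectors; this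
  -- bounds the index of `H` by `(dim V) ^ 2`.
  let T : B → Module.End K (Module.End K V) := fun x =>
    (LinearMap.mulLeft K (ρ x)).comp (LinearMap.mulRight K (ρ (x : G)⁻¹))
  have hidx := H.index_le_finrank_of_joint_eigenvectors T (fun g => ρ (g * b * g⁻¹)) c
    (fun g => ρ.apply_ne_zero _)
    (fun g x => by
      rw [← hc]
      simp [T, mul_assoc])
    (fun g h hgh => by
      -- Two conjugates of `b` with the same eigenvalues differ by an element commuting with `B`,
      -- hence by a scalar.
      obtain ⟨l, hl⟩ := hcent ((g * b * g⁻¹)⁻¹ * (h * b * h⁻¹))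
        (B.mul_mem (B.inv_mem (hB.conj_mem b hb g)) (hB.conj_mem b hb h)) (by
          intro x hx
          have e1 : ρ (x * (g * b * g⁻¹) * x⁻¹) = _ := hc g ⟨x, hx⟩
          have e2 : ρ (x * (h * b * h⁻¹) * x⁻¹) = _ := hc h ⟨x, hx⟩
          rw [← congrFun hgh ⟨x, hx⟩] at e2
          generalize c g ⟨x, hx⟩ = l at e1 e2
          generalize g * b * g⁻¹ = y at e1 e2 ⊢
          generalize h * b * h⁻¹ = z at e1 e2 ⊢
          have hl0 : l ≠ 0 := by
            rintro rfl
            rw [zero_smul] at e1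
            exact ρ.apply_ne_zero _ e1
          have f1 : l • ρ (x * y⁻¹) = ρ (y⁻¹ * x) := by
            have : y⁻¹ * x = y⁻¹ * (x * y * x⁻¹) * (x * y⁻¹) := by group
            rw [this, map_mul ρ (y⁻¹ * _), map_mul ρ y⁻¹, e1, mul_smul_comm, smul_mul_assoc,
              ← map_mul, ← map_mul, inv_mul_cancel, one_mul]
          have f2 : ρ (x * z) = l • ρ (z * x) := by
            have : x * z = x * z * x⁻¹ * x := by group
            rw [this, map_mul, e2, smul_mul_assoc, ← map_mul]
          have f3 : l • ρ (y⁻¹ * z * x) = l • ρ (x * (y⁻¹ * z)) := by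
            rw [← mul_assoc, map_mul ρ (x * y⁻¹), ← smul_mul_assoc, f1, ← map_mul, mul_assoc,
              mul_assoc, map_mul ρ y⁻¹, map_mul ρ y⁻¹, f2, mul_smul_comm]
          have f4 := smul_right_injective _ hl0 f3
          rw [Commute, SemiconjBy, ← map_mul, ← map_mul, f4])
      refine ⟨l, ?_⟩
      have : g⁻¹ * h * b * (g⁻¹ * h)⁻¹ =
          g⁻¹ * (g * b * g⁻¹) * ((g * b * g⁻¹)⁻¹ * (h * b * h⁻¹)) * g := by group
      rw [this, map_mul, map_mul, hl, mul_smul_comm, smul_mul_assoc, mul_one, ← map_mul]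
      congr 2; group)
  -- The elements commuting with `ρ b`; they preserve its eigenspaces.
  let H' : Subgroup G :=
    { carrier := {g | ρ (g * b * g⁻¹) = ρ b}
      one_mem' := by simp
      mul_mem' := by
        rintro g h (hg : ρ (g * b * g⁻¹) = ρ b) (hh : ρ (h * b * h⁻¹) = ρ b)
        have : g * h * b * (g * h)⁻¹ = g * (h * b * h⁻¹) * g⁻¹ := by group
        change ρ _ = ρ b
        rw [this, map_mul, map_mul, hh, ← map_mul, ← map_mul, hg]
      inv_mem' := by
        rintro g (hg : ρ (g * b * g⁻¹) = ρ b)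
        have : b = g⁻¹ * (g * b * g⁻¹) * g := by group
        change ρ _ = ρ b
        conv_rhs => rw [this]
        rw [map_mul ρ (g⁻¹ * (g * b * g⁻¹)), map_mul ρ g⁻¹ (g * b * g⁻¹), hg, ← map_mul,
          ← map_mul, inv_inv] }
  have hH' : H' ≤ H := fun g hg => ⟨1, by rw [one_smul]; exact hg⟩
  choose l hl using fun h : H => h.2
  have hl1 : ∀ h : H, l h * l h⁻¹ = 1 := by
    intro h
    have h1 := hl h⁻¹
    have : b = (h : G) * ((h⁻¹ : H) * b * ((h⁻¹ : H) : G)⁻¹) * (h : G)⁻¹ := by simp; group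
    have h2 : (l h * l h⁻¹) • ρ b = (1 : K) • ρ b := by
      rw [one_smul]
      conv_rhs => rw [this]
      rw [map_mul, map_mul, h1, mul_smul_comm, smul_mul_assoc, ← map_mul, ← map_mul, hl, smul_smul,
        mul_comm]
    exact smul_left_injective K (ρ.apply_ne_zero b) h2
  obtain ⟨μ, hμ⟩ := Module.End.exists_eigenvalue (ρ b)
  obtain ⟨w, hw⟩ := hμ.exists_hasEigenvector
  have hwμ : ρ b w = μ • w := hw.apply_eq_smul
  have hμ0 : μ ≠ 0 := by
    rintro rfl
    rw [zero_smul] at hwμ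
    exact ρ.apply_vec_ne_zero b hw.2 hwμ
  -- An `h ∈ H` carries the `μ`-eigenvector `w` to one with eigenvalue `l h⁻¹ * μ`. As `ρ b` has at
  -- most `dim V` eigenvalues, this bounds the index of `H'` in `H`.
  have hidx' := (H'.subgroupOf H).index_le_finrank_of_joint_eigenvectors
    (fun _ : Unit => (ρ b : Module.End K V)) (fun h => ρ h w) (fun h _ => l h⁻¹ * μ)
    (fun h => ρ.apply_vec_ne_zero _ hw.2)
    (fun h _ => by
      have : b * h = h * ((h⁻¹ : H) * b * ((h⁻¹ : H) : G)⁻¹) := by simp; group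
      rw [← Module.End.mul_apply, ← map_mul, this, map_mul, hl, Module.End.mul_apply,
        LinearMap.smul_apply, hwμ, map_smul, map_smul, smul_smul])
    (fun h k hhk => by
      have e : l h⁻¹ = l k⁻¹ := mul_right_cancel₀ hμ0 (congrFun hhk ())
      rw [Subgroup.mem_subgroupOf]
      change ρ _ = ρ b
      have : ((h⁻¹ * k : H) : G) * b * ((h⁻¹ * k : H) : G)⁻¹ =
          ((h⁻¹ : H) : G) * (k * b * (k : G)⁻¹) * ((h⁻¹ : H) : G)⁻¹ := by simp; group
      rw [this, map_mul, map_mul, hl k, mul_smul_comm, smul_mul_assoc, ← map_mul, ← map_mul, hl,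
        smul_smul, e, hl1, one_smul])
  have hind := Subgroup.relIndex_mul_index hH'
  rw [Subgroup.relIndex] at hind
  change _ ∧ _ ≤ Module.finrank K (V →ₗ[K] V) at hidx
  rw [Module.finrank_linearMap] at hidx
  refine ⟨H', Module.End.eigenspace (ρ b) μ, ?_, ?_, hμ, ?_, ?_⟩
  · rw [← hind]; exact mul_ne_zero hidx'.1 hidx.1
  · rw [← hind, pow_succ', sq]; exact Nat.mul_le_mul hidx'.2 hidx.2
  · intro h
    refine hbs ⟨μ, LinearMap.ext fun v => ?_⟩
    have : v ∈ Module.End.eigenspace (ρ b) μ := h ▸ Submodule.mem_top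
    simpa using Module.End.mem_eigenspace_iff.1 this
  · intro h (hh : ρ (h * b * h⁻¹) = ρ b) v hv
    have hv' := Module.End.mem_eigenspace_iff.1 hv
    refine Module.End.mem_eigenspace_iff.2 ?_
    rw [← hh, ← Module.End.mul_apply, ← map_mul, inv_mul_cancel_right, map_mul,
      Module.End.mul_apply, hv', map_smul]

/-- A solvable group that does not act by scalars has a subgroup of index at most `(dim V) ^ 3`
that stabilizes a proper nonzero subspace. -/
theorem exists_invariant_of_isSolvable [Group.IsSolvable G] (ρ : Representation K G V)
    (hns : ρ.scalarSubgroup ≠ ⊤) :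
    ∃ (H : Subgroup G) (W : Submodule K V), H.index ≠ 0 ∧ H.index ≤ Module.finrank K V ^ 3 ∧
      W ≠ ⊥ ∧ W ≠ ⊤ ∧ ∀ h ∈ H, W ≤ W.comap (ρ h) := by
  classical
  have hex : ∃ k, derivedSeries G k ≤ ρ.scalarSubgroup := by
    obtain ⟨k, hk⟩ := Group.IsSolvable.solvable (G := G)
    exact ⟨k, by rw [hk]; exact bot_le⟩
  -- `derivedSeries G k` is the last derived subgroup that is not scalar, so its commutators are
  -- scalar.
  obtain ⟨k, hk⟩ : ∃ k, Nat.find hex = k + 1 := by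
    refine Nat.exists_eq_succ_of_ne_zero fun h => hns (top_le_iff.1 ?_)
    have := Nat.find_spec hex
    rwa [h, derivedSeries_zero] at this
  have hB : ¬ derivedSeries G k ≤ ρ.scalarSubgroup := Nat.find_min hex (by omega)
  have hBB : ⁅derivedSeries G k, derivedSeries G k⁆ ≤ ρ.scalarSubgroup := by
    have := Nat.find_spec hex
    rwa [hk, derivedSeries_succ] at this
  have hBn : (derivedSeries G k).Normal := inferInstance
  generalize derivedSeries G k = B at hB hBB hBn
  by_cases hcent : ∀ z ∈ B, (∀ b ∈ B, Commute (ρ z) (ρ b)) → z ∈ ρ.scalarSubgroup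
  · exact ρ.exists_invariant_of_normal_scalar_commutator B hBB hB hcent
  push Not at hcent
  obtain ⟨z, hzB, hzc, hzs⟩ := hcent
  have hcomm_iff : ∀ a b : G, Commute (ρ a) (ρ b) ↔ Commute (ρ.asGroupHom a) (ρ.asGroupHom b) := by
    intro a b
    rw [commute_iff_eq, commute_iff_eq, Units.ext_iff]
    rfl
  -- The elements of `B` that act centrally on `ρ(B)`: commuting, normal in `G`, and not all scalar
  -- in this case.
  let A : Subgroup G := B ⊓ (Subgroup.centralizer (B.map ρ.asGroupHom)).comap ρ.asGroupHom
  have hmemA : ∀ a, a ∈ A ↔ a ∈ B ∧ ∀ b ∈ B, Commute (ρ a) (ρ b) := by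
    intro a
    simp only [A, Subgroup.mem_inf, Subgroup.mem_comap, Subgroup.mem_centralizer_iff, hcomm_iff]
    simp only [Subgroup.coe_map, Set.forall_mem_image, SetLike.mem_coe]
    exact and_congr_right fun _ => forall₂_congr fun b _ => eq_comm
  have hA : A.Normal := by
    refine ⟨fun a ha g => (hmemA _).2 ?_⟩
    obtain ⟨haB, hac⟩ := (hmemA a).1 ha
    refine ⟨hBn.conj_mem a haB g, fun b hb => ?_⟩
    have h1 := hac (g⁻¹ * b * g) (by simpa using hBn.conj_mem b hb g⁻¹)
    rw [hcomm_iff] at h1 ⊢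
    have h2 := h1.conj (ρ.asGroupHom g)
    simpa [mul_assoc] using h2
  obtain ⟨H, W, h0, hle, hW⟩ := ρ.exists_invariant_of_normal_commuting A
    (fun a ha b hb => ((hmemA a).1 ha).2 b ((hmemA b).1 hb).1)
    (fun h => hzs (h ((hmemA z).2 ⟨hzB, hzc⟩)))
  exact ⟨H, W, h0, hle.trans (Nat.le_self_pow (by norm_num) _), hW⟩

end Representation

/-! ### Trigonalizable representations and Mal'cev's theorem -/

namespace Representation

section Trigonalizable

variable {K G V : Type*} [Field K] [Group G] [AddCommGroup V] [Module K V]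

/-- A representation is trigonalizable if every nonzero invariant subquotient contains an
eigenvector of the whole group. -/
def IsTrigonalizable (ρ : Representation K G V) : Prop :=
  ∀ W₁ W₂ : Submodule K V, (∀ g, W₁ ≤ W₁.comap (ρ g)) → (∀ g, W₂ ≤ W₂.comap (ρ g)) →
    W₁ < W₂ → ∃ w ∈ W₂, w ∉ W₁ ∧ ∀ g, ∃ c : K, ρ g w - c • w ∈ W₁

theorem isTrigonalizable_of_scalar {ρ : Representation K G V} (h : ρ.scalarSubgroup = ⊤) :
    ρ.IsTrigonalizable := by
  intro W₁ W₂ _ _ hlt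
  obtain ⟨w, hw, hw'⟩ := SetLike.exists_of_lt hlt
  refine ⟨w, hw, hw', fun g => ?_⟩
  obtain ⟨c, hc⟩ : g ∈ ρ.scalarSubgroup := h ▸ Subgroup.mem_top g
  exact ⟨c, by simp [hc]⟩

/-- A trigonalizable representation has an adapted linearly independent family of every size up
to its dimension. -/
theorem IsTrigonalizable.exists_family [FiniteDimensional K V] {ρ : Representation K G V}
    (hρ : ρ.IsTrigonalizable) (k : ℕ) (hk : k ≤ Module.finrank K V) :
    ∃ b : Fin k → V, LinearIndependent K b ∧
      ∀ j g, ∃ c : K, ρ g (b j) - c • b j ∈ Submodule.span K (b '' {i | i < j}) := by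
  induction k with
  | zero => exact ⟨Fin.elim0, linearIndependent_empty_type, fun j => j.elim0⟩
  | succ k ih =>
    obtain ⟨b, hb, hbt⟩ := ih (by omega)
    have hne : Submodule.span K (Set.range b) < ⊤ := by
      refine lt_top_iff_ne_top.2 fun h => ?_
      have := finrank_span_eq_card hb
      rw [h, finrank_top, Fintype.card_fin] at this
      omega
    have hinv : ∀ g, Submodule.span K (Set.range b) ≤
        (Submodule.span K (Set.range b)).comap (ρ g) := by
      intro g
      rw [Submodule.span_le]
      rintro _ ⟨j, rfl⟩
      obtain ⟨c, hc⟩ := hbt j g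
      have h1 := Submodule.span_mono (Set.image_subset_range b _) hc
      have h2 := Submodule.add_mem _ h1
        (Submodule.smul_mem _ c (Submodule.subset_span (Set.mem_range_self j)))
      simpa using h2
    -- The next basis vector is an eigenvector in the quotient of `V` by the span so far.
    obtain ⟨w, -, hw, hwt⟩ := hρ _ ⊤ hinv (fun _ _ _ => Submodule.mem_top) hne
    refine ⟨Fin.snoc b w, hb.finSnoc hw, fun j => ?_⟩
    refine Fin.lastCases ?_ (fun j => ?_) j
    · intro g
      obtain ⟨c, hc⟩ := hwt g
      refine ⟨c, ?_⟩
      rw [Fin.snoc_last]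
      refine Submodule.span_mono ?_ hc
      rintro _ ⟨i, rfl⟩
      exact ⟨i.castSucc, Fin.castSucc_lt_last i, Fin.snoc_castSucc (α := fun _ => V) _ _ _⟩
    · intro g
      obtain ⟨c, hc⟩ := hbt j g
      refine ⟨c, ?_⟩
      rw [Fin.snoc_castSucc (α := fun _ => V)]
      refine Submodule.span_mono ?_ hc
      rintro _ ⟨i, hi, rfl⟩
      exact ⟨i.castSucc, Fin.castSucc_lt_castSucc_iff.2 hi,
        Fin.snoc_castSucc (α := fun _ => V) _ _ _⟩

/-- A trigonalizable representation has a flag with scalar action on the successive quotients. -/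
theorem IsTrigonalizable.exists_flag [FiniteDimensional K V] {ρ : Representation K G V}
    (hρ : ρ.IsTrigonalizable) :
    ∃ F : ℕ → Submodule K V, F 0 = ⊥ ∧ (∃ k, F k = ⊤) ∧
      ∀ k, ∀ w ∈ F (k + 1), ∀ g, ∃ c : K, ρ g w - c • w ∈ F k := by
  obtain ⟨b, hb, hbt⟩ := hρ.exists_family _ le_rfl
  let F : ℕ → Submodule K V := fun k => Submodule.span K (b '' {i | (i : ℕ) < k})
  have hF : ∀ k g, ∀ w ∈ F k, ρ g w ∈ F k := by
    intro k g
    change F k ≤ (F k).comap (ρ g)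
    rw [Submodule.span_le]
    rintro _ ⟨j, hj, rfl⟩
    obtain ⟨c, hc⟩ := hbt j g
    have hsub : {i | i < j} ⊆ {i : Fin (Module.finrank K V) | (i : ℕ) < k} :=
      fun i hi => lt_trans (Fin.lt_def.1 hi) hj
    have h1 : ρ g (b j) - c • b j ∈ F k := Submodule.span_mono (Set.image_mono hsub) hc
    have h2 := Submodule.add_mem _ h1 (Submodule.smul_mem _ c
      (Submodule.subset_span (Set.mem_image_of_mem b hj)))
    simpa using h2
  refine ⟨F, by simp [F], ⟨Module.finrank K V, ?_⟩, ?_⟩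
  · have : {i : Fin (Module.finrank K V) | (i : ℕ) < Module.finrank K V} = Set.univ :=
      Set.eq_univ_of_forall fun i => i.2
    simp only [F, this, Set.image_univ]
    exact hb.span_eq_top_of_card_eq_finrank' (by simp)
  · intro k w hw g
    by_cases hk : k < Module.finrank K V
    · have hset : {i : Fin (Module.finrank K V) | (i : ℕ) < k + 1} =
          insert ⟨k, hk⟩ {i : Fin (Module.finrank K V) | (i : ℕ) < k} := by
        ext i; simp [Fin.ext_iff]; omega
      simp only [F, hset, Set.image_insert_eq] at hw
      obtain ⟨a, f, hf, rfl⟩ := Submodule.mem_span_insert.1 hw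
      obtain ⟨c, hc⟩ := hbt ⟨k, hk⟩ g
      refine ⟨c, ?_⟩
      have hsub : {i | i < ⟨k, hk⟩} ⊆ {i : Fin (Module.finrank K V) | (i : ℕ) < k} :=
        fun i hi => Fin.lt_def.1 hi
      have h1 : ρ g (b ⟨k, hk⟩) - c • b ⟨k, hk⟩ ∈ F k :=
        Submodule.span_mono (Set.image_mono hsub) hc
      have h2 := Submodule.add_mem _ (Submodule.smul_mem _ a h1)
        (Submodule.sub_mem _ (hF k g f hf) (Submodule.smul_mem _ c hf))
      convert h2 using 1
      simp only [map_add, map_smul, smul_add, smul_sub, smul_comm c a]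
      abel
    -- Beyond the dimension the flag is constant, so any scalar would do.
    · refine ⟨0, ?_⟩
      have hset : {i : Fin (Module.finrank K V) | (i : ℕ) < k + 1} =
          {i : Fin (Module.finrank K V) | (i : ℕ) < k} := by
        ext i; have := i.2; simp; omega
      simp only [F, hset] at hw
      rw [zero_smul, sub_zero]
      exact hF k g w hw

/-- Take the least `k + 1` for which `W₂ ⊓ F (k + 1)` is not inside `W₁`. A vector witnessing this
is an eigenvector modulo `W₂ ⊓ F k ≤ W₁`. -/
theorem IsTrigonalizable.of_flag {ρ : Representation K G V} (F : ℕ → Submodule K V)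
    (h0 : F 0 = ⊥) (htop : ∃ k, F k = ⊤)
    (hF : ∀ k, ∀ w ∈ F (k + 1), ∀ g, ∃ c : K, ρ g w - c • w ∈ F k) : ρ.IsTrigonalizable := by
  classical
  intro W₁ W₂ _ hW₂ hlt
  have hex : ∃ k, ¬ W₂ ⊓ F k ≤ W₁ := by
    obtain ⟨k, hk⟩ := htop
    exact ⟨k, by rw [hk, inf_top_eq]; exact not_le_of_gt hlt⟩
  obtain ⟨k, hk⟩ : ∃ k, Nat.find hex = k + 1 := by
    refine Nat.exists_eq_succ_of_ne_zero fun h => ?_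
    have := Nat.find_spec hex
    rw [h, h0, inf_bot_eq] at this
    exact this bot_le
  have h1 : W₂ ⊓ F k ≤ W₁ := not_not.1 (Nat.find_min hex (by omega))
  have h2 := Nat.find_spec hex
  rw [hk] at h2
  obtain ⟨w, ⟨hw2, hwF⟩, hw1⟩ := SetLike.not_le_iff_exists.1 h2
  refine ⟨w, hw2, hw1, fun g => ?_⟩
  obtain ⟨c, hc⟩ := hF k w hwF g
  exact ⟨c, h1 ⟨Submodule.sub_mem _ (hW₂ g hw2) (Submodule.smul_mem _ c hw2), hc⟩⟩

/-- A smaller group may have more invariant subspaces, so the definition does not restrict at once;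
a flag does. -/
theorem IsTrigonalizable.comp [FiniteDimensional K V] {G' : Type*} [Group G']
    {ρ : Representation K G V} (hρ : ρ.IsTrigonalizable) (f : G' →* G) :
    IsTrigonalizable (V := V) (MonoidHom.comp ρ f) := by
  obtain ⟨F, h0, htop, hF⟩ := hρ.exists_flag
  exact .of_flag F h0 htop fun k w hw g => hF k w hw (f g)

/-- If `W₂ ⊓ W ≤ W₁`, then `W₂ / W₁` embeds as a subquotient of `V / W`; otherwise it contains a
nonzero subquotient of `W`. -/
theorem IsTrigonalizable.of_quotient {ρ : Representation K G V} (W : Submodule K V)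
    (hW : ∀ g, W ≤ W.comap (ρ g)) (h₁ : (ρ.subrepresentation W hW).IsTrigonalizable)
    (h₂ : (ρ.quotient W hW).IsTrigonalizable) : ρ.IsTrigonalizable := by
  intro W₁ W₂ hW₁ hW₂ hlt
  by_cases hle : W₂ ⊓ W ≤ W₁
  · obtain ⟨w, hw, hw', hwt⟩ := h₂ (W₁.map W.mkQ) (W₂.map W.mkQ)
      (by
        rintro g _ ⟨x, hx, rfl⟩
        exact ⟨ρ g x, hW₁ g hx, rfl⟩)
      (by
        rintro g _ ⟨x, hx, rfl⟩
        exact ⟨ρ g x, hW₂ g hx, rfl⟩)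
      (by
        refine lt_of_le_of_ne (Submodule.map_mono hlt.le) fun h => hlt.not_ge fun x hx => ?_
        have : W.mkQ x ∈ W₁.map W.mkQ := h ▸ Submodule.mem_map_of_mem hx
        obtain ⟨y, hy, hyx⟩ := this
        have hxy : x - y ∈ W := (Submodule.Quotient.eq W).1 hyx.symm
        have := Submodule.add_mem _ (hle ⟨Submodule.sub_mem _ hx (hlt.le hy), hxy⟩) hy
        simpa using this)
    obtain ⟨x, hx, rfl⟩ := hw
    refine ⟨x, hx, fun h => hw' (Submodule.mem_map_of_mem h), fun g => ?_⟩
    obtain ⟨c, y, hy, hyc⟩ := hwt g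
    refine ⟨c, ?_⟩
    have hxy : ρ g x - c • x - y ∈ W := (Submodule.Quotient.eq W).1 hyc.symm
    have := Submodule.add_mem _ (hle ⟨Submodule.sub_mem _
      (Submodule.sub_mem _ (hW₂ g hx) (Submodule.smul_mem _ c hx)) (hlt.le hy), hxy⟩) hy
    simpa using this
  · obtain ⟨w, hw, hw', hwt⟩ := h₁ ((W₁ ⊓ W).comap W.subtype) (W₂.comap W.subtype)
      (fun g x hx => ⟨hW₁ g hx.1, hW g hx.2⟩) (fun g x hx => hW₂ g hx)
      (by
        obtain ⟨x, hx, hx'⟩ := SetLike.not_le_iff_exists.1 hle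
        refine SetLike.lt_iff_le_and_exists.2 ⟨fun y hy => hlt.le hy.1, ⟨x, hx.2⟩, hx.1, ?_⟩
        exact fun h => hx' h.1)
    refine ⟨w, hw, fun h => hw' ⟨h, w.2⟩, fun g => ?_⟩
    obtain ⟨c, hc⟩ := hwt g
    exact ⟨c, hc.1⟩

/-- The bound for the index of a trigonalizable subgroup of a solvable linear group. -/
def _root_.malcevBound : ℕ → ℕ
  | 0 => 1
  -- The cube pays for an invariant subspace `W`, the other factors for `W` and `V / W`, both of
  -- dimension at most `n`.
  | n + 1 => (n + 1) ^ 3 * (malcevBound n * malcevBound n)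

theorem _root_.malcevBound_pos (n : ℕ) : 0 < malcevBound n := by
  induction n with
  | zero => exact Nat.one_pos
  | succ n ih => exact Nat.mul_pos (by positivity) (Nat.mul_pos ih ih)

/-- **Mal'cev's theorem**: a solvable linear group over an algebraically closed field has a
trigonalizable subgroup of index bounded in terms of the dimension. -/
theorem exists_isTrigonalizable_of_isSolvable {K : Type*} [Field K] [IsAlgClosed K] (n : ℕ) :
    ∀ {G : Type*} {V : Type*} [Group G] [Group.IsSolvable G] [AddCommGroup V] [Module K V]
      [FiniteDimensional K V] (ρ : Representation K G V), Module.finrank K V ≤ n →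
      ∃ H : Subgroup G, H.index ≠ 0 ∧ H.index ≤ malcevBound n ∧
        IsTrigonalizable (V := V) (MonoidHom.comp ρ H.subtype) := by
  induction n with
  | zero =>
    intro G V _ _ _ _ _ ρ hV
    have : Subsingleton V := Module.finrank_zero_iff.1 (Nat.le_zero.1 hV)
    exact ⟨⊤, by simp, by simp [malcevBound], fun W₁ W₂ _ _ h =>
      absurd (Subsingleton.elim W₁ W₂) h.ne⟩
  | succ n ih =>
    intro G V _ _ _ _ _ ρ hV
    by_cases hs : ρ.scalarSubgroup = ⊤
    · exact ⟨⊤, by simp, by rw [Subgroup.index_top]; exact malcevBound_pos (n + 1),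
        (isTrigonalizable_of_scalar hs).comp _⟩
    have hnt : Nontrivial V := by
      by_contra h
      rw [not_nontrivial_iff_subsingleton] at h
      exact hs (top_le_iff.1 fun g _ => ⟨1, Subsingleton.elim _ _⟩)
    obtain ⟨H, W, hH0, hH, hWb, hWt, hWH⟩ := ρ.exists_invariant_of_isSolvable hs
    let σ : Representation K H V := MonoidHom.comp ρ H.subtype
    have hσ : ∀ h, W ≤ W.comap (σ h) := fun h => hWH h h.2
    have d1 : Module.finrank K W ≤ n := by
      have := Submodule.finrank_lt hWt; omega
    have d2 : Module.finrank K (V ⧸ W) ≤ n := by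
      have := Submodule.finrank_quotient_add_finrank W
      have := Submodule.one_le_finrank_iff.2 hWb
      omega
    obtain ⟨H₁, h₁0, h₁, t₁⟩ := ih (σ.subrepresentation W hσ) d1
    obtain ⟨H₂, h₂0, h₂, t₂⟩ := ih (σ.quotient W hσ) d2
    have hi := Subgroup.index_map_subtype (H₁ ⊓ H₂)
    refine ⟨(H₁ ⊓ H₂).map H.subtype, ?_, ?_, ?_⟩
    · rw [hi]; exact mul_ne_zero (Subgroup.index_inf_ne_zero h₁0 h₂0) hH0
    · rw [hi, mul_comm, malcevBound]
      exact Nat.mul_le_mul (hH.trans (Nat.pow_le_pow_left hV 3))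
        (Subgroup.index_inf_le.trans (Nat.mul_le_mul h₁ h₂))
    · have key : IsTrigonalizable (V := V) (MonoidHom.comp σ (H₁ ⊓ H₂).subtype) :=
        IsTrigonalizable.of_quotient W (fun g => hσ g)
          (t₁.comp (Subgroup.inclusion inf_le_left)) (t₂.comp (Subgroup.inclusion inf_le_right))
      let e := (H₁ ⊓ H₂).equivMapOfInjective H.subtype H.subtype_injective
      have := key.comp e.symm.toMonoidHom
      convert this using 1
      ext g : 1
      obtain ⟨x, rfl⟩ := e.surjective g
      simp [σ, e]

end Trigonalizable

end Representation

/-! ### Finite `p`-groups acting in characteristic `p` -/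

namespace Representation

section Unipotent

variable {K G V : Type*} [Field K] [Group G] [AddCommGroup V] [Module K V]

/-- A finite `p`-group acting on a nonzero vector space in characteristic `p` has a nonzero fixed
vector. -/
theorem exists_fixed_ne_zero_of_isPGroup {p : ℕ} [Fact p.Prime] [CharP K p] [Finite G]
    [Nontrivial V] (hG : IsPGroup p G) (ρ : Representation K G V) :
    ∃ v : V, v ≠ 0 ∧ ∀ g, ρ g v = v := by
  obtain ⟨v₀, hv₀⟩ := exists_ne (0 : V)
  -- `K` may be infinite, so fixed points are counted in the additive group generated by one orbit,
  -- which is finite of exponent `p`.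
  let A : AddSubgroup V := AddSubgroup.closure (Set.range fun g => ρ g v₀)
  have hA : ∀ g, ∀ a ∈ A, ρ g a ∈ A := by
    intro g
    change A ≤ A.comap (ρ g).toAddMonoidHom
    rw [AddSubgroup.closure_le]
    rintro _ ⟨h, rfl⟩
    refine AddSubgroup.subset_closure ⟨g * h, ?_⟩
    simp
  have hpV : ∀ v : V, p • v = 0 := fun v => by
    rw [← Nat.cast_smul_eq_nsmul K, CharP.cast_eq_zero, zero_smul]
  have hfg : AddGroup.FG A := AddGroup.closure_finite_fg _
  have hfin : Finite A := AddCommGroup.finite_of_fg_isAddTorsion _ fun a =>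
    isOfFinAddOrder_iff_nsmul_eq_zero.2 ⟨p, (Fact.out : p.Prime).pos, Subtype.ext (hpV a)⟩
  let _ : MulAction G A :=
    { smul := fun g a => ⟨ρ g a, hA g a a.2⟩
      one_smul := fun a => Subtype.ext (by change ρ 1 _ = _; simp)
      mul_smul := fun g h a => Subtype.ext (by change ρ (g * h) _ = ρ g (ρ h _); simp) }
  have hv₀A : v₀ ∈ A := AddSubgroup.subset_closure ⟨1, by simp⟩
  have hdvd : p ∣ Nat.card A := by
    have h1 : addOrderOf (⟨v₀, hv₀A⟩ : A) = p :=
      addOrderOf_eq_prime (Subtype.ext (hpV v₀)) fun h => hv₀ (congrArg Subtype.val h)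
    rw [← h1]
    exact addOrderOf_dvd_natCard _
  obtain ⟨v, hv, hne⟩ := hG.exists_fixed_point_of_prime_dvd_card_of_fixed_point A hdvd
    (a := 0) (fun g => Subtype.ext (map_zero (ρ g)))
  exact ⟨v, fun h => hne (Subtype.ext h.symm), fun g => congrArg Subtype.val (hv g)⟩

theorem exists_fixed_mod_of_isPGroup {p : ℕ} [Fact p.Prime] [CharP K p] [Finite G]
    (hG : IsPGroup p G) (ρ : Representation K G V) (W₁ W₂ : Submodule K V)
    (hW₁ : ∀ g, W₁ ≤ W₁.comap (ρ g)) (hW₂ : ∀ g, W₂ ≤ W₂.comap (ρ g)) (hlt : W₁ < W₂) :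
    ∃ w ∈ W₂, w ∉ W₁ ∧ ∀ g, ρ g w - w ∈ W₁ := by
  let U : Submodule K W₂ := W₁.comap W₂.subtype
  have hU : ∀ g, U ≤ U.comap (ρ.subrepresentation W₂ hW₂ g) := fun g x hx => hW₁ g hx
  have hne : Nontrivial (W₂ ⧸ U) := by
    refine Submodule.Quotient.nontrivial_iff.2 fun h => hlt.not_ge fun x hx => ?_
    have : (⟨x, hx⟩ : W₂) ∈ U := h ▸ Submodule.mem_top
    exact this
  obtain ⟨v, hv0, hv⟩ :=
    exists_fixed_ne_zero_of_isPGroup hG ((ρ.subrepresentation W₂ hW₂).quotient U hU)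
  obtain ⟨w, rfl⟩ := U.mkQ_surjective v
  refine ⟨w, w.2, fun h => hv0 ((Submodule.Quotient.mk_eq_zero U).2 h), fun g => ?_⟩
  have := (Submodule.Quotient.eq U).1 (hv g)
  exact this

/-- The product of a `p`-group, in characteristic `p`, with a trigonalizable group that
normalizes it is trigonalizable. -/
theorem IsTrigonalizable.sup_of_isPGroup {p : ℕ} [Fact p.Prime] [CharP K p]
    (ρ : Representation K G V) (S A : Subgroup G) [Finite S] (hS : IsPGroup p S)
    (hA : A ≤ Subgroup.normalizer (S : Set G))
    (hρ : IsTrigonalizable (V := V) (MonoidHom.comp ρ A.subtype)) :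
    IsTrigonalizable (V := V) (MonoidHom.comp ρ (S ⊔ A).subtype) := by
  intro W₁ W₂ hW₁ hW₂ hlt
  replace hW₁ : ∀ g ∈ S ⊔ A, ∀ w ∈ W₁, ρ g w ∈ W₁ := fun g hg => hW₁ ⟨g, hg⟩
  replace hW₂ : ∀ g ∈ S ⊔ A, ∀ w ∈ W₂, ρ g w ∈ W₂ := fun g hg => hW₂ ⟨g, hg⟩
  -- The vectors of `W₂` fixed by `S` modulo `W₁`. They are `A`-invariant because `A` normalizes
  -- `S`, so an eigenvector of `A` in `U / W₁` is one for all of `S ⊔ A`.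
  let U : Submodule K V :=
    { carrier := {w | w ∈ W₂ ∧ ∀ s ∈ S, ρ s w - w ∈ W₁}
      zero_mem' := ⟨W₂.zero_mem, fun s _ => by simp⟩
      add_mem' := fun {a b} ha hb => ⟨W₂.add_mem ha.1 hb.1, fun s hs => by
        have := W₁.add_mem (ha.2 s hs) (hb.2 s hs)
        rw [map_add]
        convert this using 1
        abel⟩
      smul_mem' := fun c a ha => ⟨W₂.smul_mem c ha.1, fun s hs => by
        rw [map_smul, ← smul_sub]
        exact W₁.smul_mem c (ha.2 s hs)⟩ }
  have hle : W₁ ≤ U := fun w hw => ⟨hlt.le hw, fun s hs =>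
    W₁.sub_mem (hW₁ s (Subgroup.mem_sup_left hs) w hw) hw⟩
  have hltU : W₁ < U := by
    obtain ⟨w, hw, hw', hwS⟩ := exists_fixed_mod_of_isPGroup hS (MonoidHom.comp ρ S.subtype) W₁ W₂
      (fun g => hW₁ g (Subgroup.mem_sup_left g.2)) (fun g => hW₂ g (Subgroup.mem_sup_left g.2)) hlt
    have hwU : w ∈ U := ⟨hw, fun s hs => hwS ⟨s, hs⟩⟩
    exact SetLike.lt_iff_le_and_exists.2 ⟨hle, w, hwU, hw'⟩
  obtain ⟨w, hw, hw', hwA⟩ := hρ W₁ U (fun a => hW₁ a (Subgroup.mem_sup_right a.2))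
    (fun a w hw => ⟨hW₂ a (Subgroup.mem_sup_right a.2) w hw.1, fun s hs => by
      have h1 : (a : G)⁻¹ * s * a ∈ S := by
        simpa using (Subgroup.mem_normalizer_iff.1 (inv_mem (hA a.2)) s).1 hs
      have h2 := hW₁ a (Subgroup.mem_sup_right a.2) _ (hw.2 _ h1)
      rw [map_sub, ← Module.End.mul_apply, ← map_mul] at h2
      change ρ s (ρ a w) - ρ a w ∈ W₁
      rw [← Module.End.mul_apply, ← map_mul]
      convert h2 using 4
      group⟩) hltU
  refine ⟨w, hw.1, hw', ?_⟩
  rintro ⟨g, hg⟩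
  change ∃ c : K, ρ g w - c • w ∈ W₁
  have hmul : ∀ g ∈ S ⊔ A, ∀ h, (∃ c : K, ρ g w - c • w ∈ W₁) → (∃ c : K, ρ h w - c • w ∈ W₁) →
      ∃ c : K, ρ (g * h) w - c • w ∈ W₁ := by
    rintro g hg h ⟨c, hc⟩ ⟨d, hd⟩
    refine ⟨d * c, ?_⟩
    have := W₁.add_mem (hW₁ g hg _ hd) (W₁.smul_mem d hc)
    convert this using 1
    simp only [map_mul, Module.End.mul_apply, map_sub, map_smul, smul_sub, smul_smul]
    abel
  have hg' := hg
  rw [Subgroup.sup_eq_closure] at hg'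
  have hcl : Subgroup.closure ((S : Set G) ∪ A) = S ⊔ A := Subgroup.sup_eq_closure S A |>.symm
  induction hg' using Subgroup.closure_induction with
  | mem x hx =>
    rcases hx with hx | hx
    · exact ⟨1, by rw [one_smul]; exact hw.2 x hx⟩
    · exact hwA ⟨x, hx⟩
  | one => exact ⟨1, by simp⟩
  | mul x y hx hy ihx ihy =>
    rw [hcl] at hx hy
    exact hmul x hx y (ihx hx) (ihy hy)
  | inv x hx ih =>
    rw [hcl] at hx
    obtain ⟨c, hc⟩ := ih hx
    have h1 := hW₁ x⁻¹ (inv_mem hx) _ hc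
    have h2 : ρ x⁻¹ (ρ x w) = w := by
      rw [← Module.End.mul_apply, apply_inv_mul_self, Module.End.one_apply]
    rw [map_sub, h2, map_smul] at h1
    have hc0 : c ≠ 0 := by
      rintro rfl
      rw [zero_smul, sub_zero] at h1
      exact hw' h1
    refine ⟨c⁻¹, ?_⟩
    have h3 := W₁.smul_mem (-c⁻¹) h1
    convert h3 using 1
    rw [smul_sub, smul_smul, neg_mul, inv_mul_cancel₀ hc0, neg_smul, neg_smul, one_smul]
    abel

end Unipotent

end Representation

/-! ### Upper triangular matrices and their diagonal characters -/

section Matrices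

open Matrix

variable {K : Type*} [Field K] {n : ℕ}

/-- The standard representation of `GL_n(K)` on `K ^ n`. -/
def Matrix.GeneralLinearGroup.stdRepresentation (n : ℕ) (K : Type*) [Field K] :
    Representation K (GL (Fin n) K) (Fin n → K) :=
  (Matrix.toLinAlgEquiv' : Matrix (Fin n) (Fin n) K ≃ₐ[K] _).toMonoidHom.comp
    (Units.coeHom (Matrix (Fin n) (Fin n) K))

/-- A trigonalizable linear group can be conjugated into the upper triangular matrices. -/
theorem exists_conj_blockTriangular {G : Type*} [Group G] (ρ : G →* GL (Fin n) K)
    (h : Representation.IsTrigonalizable (V := Fin n → K)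
      ((GeneralLinearGroup.stdRepresentation n K).comp ρ)) :
    ∃ x : GL (Fin n) K, ∀ g, (x * ρ g * x⁻¹).val.BlockTriangular id := by
  obtain ⟨b, hb, hbt⟩ := h.exists_family n (by simp)
  let y : Matrix (Fin n) (Fin n) K := (Matrix.of b)ᵀ
  have hy : IsUnit y := by
    rw [← Matrix.linearIndependent_cols_iff_isUnit]
    exact hb
  obtain ⟨Y, hY⟩ := hy
  have hYb : ∀ j, Y.val *ᵥ Pi.single j 1 = b j := fun j => by
    rw [hY, Matrix.mulVec_single_one]; rfl
  have hYi : ∀ j, (Y⁻¹ : GL (Fin n) K).val *ᵥ b j = Pi.single j 1 := fun j => by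
    rw [← hYb, Matrix.mulVec_mulVec, ← Units.val_mul, inv_mul_cancel, Units.val_one,
      Matrix.one_mulVec]
  refine ⟨Y⁻¹, fun g i j (hij : j < i) => ?_⟩
  obtain ⟨c, hc⟩ := hbt j g
  change (ρ g).val *ᵥ b j - c • b j ∈ _ at hc
  have hspan : ∀ w ∈ Submodule.span K (b '' {i | i < j}),
      ((Y⁻¹ : GL (Fin n) K).val *ᵥ w) i = 0 := by
    intro w hw
    have : Submodule.span K (b '' {i | i < j}) ≤
        LinearMap.ker ((LinearMap.proj i).comp (Matrix.mulVecLin (Y⁻¹ : GL (Fin n) K).val)) := by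
      rw [Submodule.span_le]
      rintro _ ⟨k, hk, rfl⟩
      have hki : i ≠ k := (lt_trans hk hij).ne'
      change ((Y⁻¹ : GL (Fin n) K).val *ᵥ b k) i = 0
      rw [hYi, Pi.single_apply, if_neg hki]
    exact this hw
  have h1 : (ρ g).val *ᵥ b j = ((ρ g).val *ᵥ b j - c • b j) + c • b j := by abel
  have h2 : (Y⁻¹ * ρ g * Y⁻¹⁻¹ : GL (Fin n) K).val *ᵥ Pi.single j 1 =
      (Y⁻¹ : GL (Fin n) K).val *ᵥ ((ρ g).val *ᵥ b j) := by
    rw [inv_inv, Units.val_mul, Units.val_mul, ← Matrix.mulVec_mulVec, hYb, ← Matrix.mulVec_mulVec]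
  have h3 := congrFun h2 i
  rw [Matrix.mulVec_single_one, Matrix.col_apply] at h3
  rw [h3, h1, Matrix.mulVec_add, Pi.add_apply, hspan _ hc, Matrix.mulVec_smul, hYi, zero_add]
  simp [hij.ne']

theorem Matrix.IsUpperTriangular.mul_apply_self {A B : Matrix (Fin n) (Fin n) K}
    (hA : A.IsUpperTriangular) (hB : B.IsUpperTriangular) (i : Fin n) :
    (A * B) i i = A i i * B i i := by
  rw [Matrix.mul_apply]
  refine Finset.sum_eq_single i (fun k _ hk => ?_) (by simp)
  rcases lt_or_gt_of_ne hk with h | h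
  · rw [show A i k = 0 from hA h, zero_mul]
  · rw [show B k i = 0 from hB h, mul_zero]

/-- The algebra of upper triangular matrices. -/
def upperTriangularSubalgebra (n : ℕ) (K : Type*) [Field K] :
    Subalgebra K (Matrix (Fin n) (Fin n) K) where
  carrier := {A | A.IsUpperTriangular}
  mul_mem' ha hb := BlockTriangular.mul ha hb
  add_mem' ha hb := BlockTriangular.add ha hb
  algebraMap_mem' c := by
    rw [Matrix.algebraMap_eq_diagonal]
    exact Matrix.blockTriangular_diagonal _

/-- A diagonal entry, as an algebra homomorphism on the upper triangular matrices. -/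
def upperTriangularDiag (K : Type*) [Field K] (i : Fin n) :
    upperTriangularSubalgebra n K →ₐ[K] K where
  toFun A := A.1 i i
  map_one' := by simp
  map_mul' A B := Matrix.IsUpperTriangular.mul_apply_self A.2 B.2 i
  map_zero' := by simp
  map_add' A B := by simp
  commutes' c := by simp [Matrix.algebraMap_eq_diagonal]

/-- The diagonal entries of a group of upper triangular matrices, as a homomorphism. -/
def diagUnitsHom {G : Type*} [Group G] (ρ : G →* GL (Fin n) K)
    (h : ∀ g, (ρ g).val.IsUpperTriangular) : G →* (Fin n → Kˣ) where
  toFun g i := ⟨(ρ g).val i i, (ρ g⁻¹).val i i,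
    by rw [← (h g).mul_apply_self (h g⁻¹), ← Units.val_mul, ← map_mul]; simp,
    by rw [← (h g⁻¹).mul_apply_self (h g), ← Units.val_mul, ← map_mul]; simp⟩
  map_one' := by ext i; simp
  map_mul' a b := by
    ext i
    simp only [map_mul, Units.val_mul, Pi.mul_apply]
    exact (h a).mul_apply_self (h b) i

theorem diagUnitsHom_apply {G : Type*} [Group G] (ρ : G →* GL (Fin n) K)
    (h : ∀ g, (ρ g).val.IsUpperTriangular) (g : G) (i : Fin n) :
    (diagUnitsHom ρ h g i : K) = (ρ g).val i i := rfl

/-- Upper unitriangular matrices over a field of characteristic `p` have `p`-power order. -/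
theorem isPGroup_ker_diagUnitsHom {p : ℕ} [Fact p.Prime] [CharP K p] {G : Type*} [Group G]
    (ρ : G →* GL (Fin n) K) (hρ : Function.Injective ρ) (h : ∀ g, (ρ g).val.IsUpperTriangular) :
    IsPGroup p (diagUnitsHom ρ h).ker := by
  rintro ⟨g, hg⟩
  have hdiag : ∀ i, (ρ g).val i i = 1 := fun i => by
    rw [← diagUnitsHom_apply ρ h, MonoidHom.mem_ker.1 hg]; simp
  -- Cayley–Hamilton with characteristic polynomial `(X - 1) ^ n`; since `n ≤ p ^ n`, the Frobenius
  -- identity then gives `g ^ p ^ n = 1`.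
  have hnil : ((ρ g).val - 1) ^ n = 0 := by
    have h1 := Matrix.aeval_self_charpoly (ρ g).val
    rw [Matrix.charpoly_of_isUpperTriangular _ (h g)] at h1
    simpa [hdiag] using h1
  -- For `n = 0` the matrix ring is trivial and does not have characteristic `p`.
  have : CharP (Matrix (Fin n) (Fin n) K) p ∨ n = 0 := by
    rcases Nat.eq_zero_or_pos n with h0 | h0
    · exact Or.inr h0
    · have : Nonempty (Fin n) := ⟨⟨0, h0⟩⟩
      exact Or.inl inferInstance
  refine ⟨n, Subtype.ext (hρ (Units.ext ?_))⟩
  rcases this with hp | h0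
  · have h2 : ((ρ g).val - 1) ^ p ^ n = 0 :=
      pow_eq_zero_of_le (Nat.lt_pow_self (Fact.out : p.Prime).one_lt).le hnil
    rw [sub_pow_char_pow_of_commute _ _ (Commute.one_right _), one_pow, sub_eq_zero] at h2
    simpa using h2
  · subst h0
    exact Subsingleton.elim _ _

/-- A homomorphism to the scalars on an algebra of upper triangular matrices is a diagonal
entry. -/
theorem exists_eq_upperTriangularDiag [Infinite K]
    (A : Subalgebra K (Matrix (Fin n) (Fin n) K)) (hA : A ≤ upperTriangularSubalgebra n K)
    (φ : A →ₐ[K] K) :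
    ∃ i, φ = (upperTriangularDiag K i).comp (Subalgebra.inclusion hA) := by
  classical
  by_contra! hne
  let ψ : Fin n → A →ₐ[K] K := fun i => (upperTriangularDiag K i).comp (Subalgebra.inclusion hA)
  -- If `φ` is no diagonal entry, these kernels are proper and cannot cover `A` over an infinite
  -- field. For `a` outside them, Cayley–Hamilton still makes `φ a` one of the diagonal entries of
  -- `a`.
  let s : Finset (Subspace K A) :=
    Finset.univ.image fun i => LinearMap.ker (φ.toLinearMap - (ψ i).toLinearMap)
  have hs : ⊤ ∉ s := by
    intro h
    obtain ⟨i, -, hi⟩ := Finset.mem_image.1 h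
    refine hne i (AlgHom.ext fun a => ?_)
    have : a ∈ LinearMap.ker (φ.toLinearMap - (ψ i).toLinearMap) := hi ▸ Submodule.mem_top
    exact sub_eq_zero.1 this
  obtain ⟨a, ha⟩ := (Set.ne_univ_iff_exists_notMem _).1
    (Subspace.biUnion_ne_univ_of_top_notMem hs)
  have ha' : ∀ i, φ a - ψ i a ≠ 0 := fun i h => ha (by
    simp only [Set.mem_iUnion]
    exact ⟨_, Finset.mem_image_of_mem _ (Finset.mem_univ i), by simpa using h⟩)
  have h1 : Polynomial.aeval a (∏ i, (Polynomial.X - Polynomial.C (ψ i a))) = 0 := by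
    apply Subtype.ext
    have h2 := Matrix.aeval_self_charpoly a.1
    rw [Matrix.charpoly_of_isUpperTriangular _ (hA a.2)] at h2
    rw [← Subalgebra.val_apply, ← Polynomial.aeval_algHom_apply]
    exact h2
  have h3 := congrArg φ h1
  rw [← Polynomial.aeval_algHom_apply, map_zero, map_prod] at h3
  obtain ⟨i, -, hi⟩ := Finset.prod_eq_zero_iff.1 h3
  exact ha' i (by simpa using hi)

/-- The normalizer of a group of upper triangular matrices permutes its diagonal characters, so a
subgroup of index at most `n!` fixes all of them. -/
theorem exists_subgroup_fixing_diag [Infinite K] {G : Type*} [Group G] (ρ : G →* GL (Fin n) K)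
    (A X : Subgroup G) (hX : X ≤ Subgroup.normalizer (A : Set G))
    (hA : ∀ a ∈ A, (ρ a).val.IsUpperTriangular) :
    ∃ Y : Subgroup X, Y.index ≠ 0 ∧ Y.index ≤ n.factorial ∧
      ∀ y ∈ Y, ∀ a ∈ A, ∀ i, (ρ (y * a * (y : G)⁻¹)).val i i = (ρ a).val i i := by
  -- Conjugation by `X`, though not triangular, preserves the algebra generated by `A`, and so
  -- permutes its characters to `K`; these are exactly the diagonal entries.
  let 𝒜 : Subalgebra K (Matrix (Fin n) (Fin n) K) :=
    Algebra.adjoin K ((fun a => (ρ a).val) '' (A : Set G))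
  have h𝒜 : 𝒜 ≤ upperTriangularSubalgebra n K :=
    Algebra.adjoin_le (by rintro _ ⟨a, ha, rfl⟩; exact hA a ha)
  let ψ : Fin n → 𝒜 →ₐ[K] K := fun i => (upperTriangularDiag K i).comp (Subalgebra.inclusion h𝒜)
  have hψ : Function.Surjective ψ := fun φ =>
    (exists_eq_upperTriangularDiag 𝒜 h𝒜 φ).imp fun _ h => h.symm
  have hfin : Finite (𝒜 →ₐ[K] K) := Finite.of_surjective ψ hψ
  have hcard : Nat.card (𝒜 →ₐ[K] K) ≤ n := by
    simpa using Nat.card_le_card_of_surjective ψ hψ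
  have hmem : ∀ x ∈ X, ∀ a ∈ 𝒜, (ρ x).val * a * (ρ x⁻¹).val ∈ 𝒜 := by
    intro x hx a ha
    have hx1 : (ρ x⁻¹).val * (ρ x).val = 1 := by rw [← Units.val_mul, ← map_mul]; simp
    have hx2 : (ρ x).val * (ρ x⁻¹).val = 1 := by rw [← Units.val_mul, ← map_mul]; simp
    induction ha using Algebra.adjoin_induction with
    | mem _ h =>
      obtain ⟨a, ha, rfl⟩ := h
      refine Algebra.subset_adjoin ⟨x * a * x⁻¹, ?_, by simp⟩
      exact (Subgroup.mem_normalizer_iff.1 (hX hx) a).1 ha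
    | algebraMap c =>
      rw [← Algebra.commutes, mul_assoc, hx2, mul_one]
      exact 𝒜.algebraMap_mem c
    | add a b _ _ ha hb => rw [mul_add, add_mul]; exact 𝒜.add_mem ha hb
    | mul a b _ _ ha hb =>
      have : (ρ x).val * (a * b) * (ρ x⁻¹).val =
          ((ρ x).val * a * (ρ x⁻¹).val) * ((ρ x).val * b * (ρ x⁻¹).val) := by
        simp only [mul_assoc]
        rw [← mul_assoc (ρ x⁻¹).val (ρ x).val, hx1, one_mul]
      rw [this]
      exact 𝒜.mul_mem ha hb
  let conj : X → 𝒜 →ₐ[K] 𝒜 := fun x =>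
    { toFun := fun a => ⟨(ρ x).val * a * (ρ (x : G)⁻¹).val, hmem x x.2 a a.2⟩
      map_one' := Subtype.ext (by
        change (ρ x).val * 1 * (ρ (x : G)⁻¹).val = 1
        rw [mul_one, ← Units.val_mul, ← map_mul]; simp)
      map_mul' := fun a b => Subtype.ext (by
        change (ρ x).val * (a * b) * (ρ (x : G)⁻¹).val =
          ((ρ x).val * a * (ρ (x : G)⁻¹).val) * ((ρ x).val * b * (ρ (x : G)⁻¹).val)
        have hx1 : (ρ (x : G)⁻¹).val * (ρ x).val = 1 := by rw [← Units.val_mul, ← map_mul]; simp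
        simp only [mul_assoc]
        rw [← mul_assoc (ρ (x : G)⁻¹).val (ρ x).val, hx1, one_mul])
      map_zero' := Subtype.ext (by simp)
      map_add' := fun a b => Subtype.ext (by simp [mul_add, add_mul])
      commutes' := fun c => Subtype.ext (by
        change (ρ x).val * algebraMap K (Matrix (Fin n) (Fin n) K) c * (ρ (x : G)⁻¹).val =
          algebraMap K _ c
        rw [← Algebra.commutes, mul_assoc, ← Units.val_mul, ← map_mul]; simp) }
  have conj_apply : ∀ x a, (conj x a : Matrix (Fin n) (Fin n) K) =
      (ρ x).val * a * (ρ (x : G)⁻¹).val := fun _ _ => rfl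
  let _ : MulAction X (𝒜 →ₐ[K] K) :=
    { smul := fun x φ => φ.comp (conj x⁻¹)
      one_smul := fun φ => AlgHom.ext fun a => by
        change φ (conj 1⁻¹ a) = φ a
        congr 1
        apply Subtype.ext
        rw [conj_apply]; simp
      mul_smul := fun x y φ => AlgHom.ext fun a => by
        change φ (conj (x * y)⁻¹ a) = φ (conj y⁻¹ (conj x⁻¹ a))
        congr 1
        apply Subtype.ext
        simp only [conj_apply]
        simp [mul_assoc] }
  have smul_apply : ∀ (x : X) (φ : 𝒜 →ₐ[K] K) (a : 𝒜), (x • φ) a = φ (conj x⁻¹ a) :=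
    fun _ _ _ => rfl
  refine ⟨(MulAction.toPermHom X (𝒜 →ₐ[K] K)).ker, ?_, ?_, ?_⟩
  · rw [Subgroup.index_ker]; exact Nat.card_pos.ne'
  · rw [Subgroup.index_ker]
    refine (Subgroup.card_le_card_group _).trans ?_
    rw [Nat.card_perm]
    exact Nat.factorial_le hcard
  · intro y hy a ha i
    -- The action of `x` precomposes with conjugation by `x⁻¹`, so conjugation by `y` is the action
    -- of `y⁻¹`.
    have h1 : y⁻¹ • ψ i = ψ i := by
      have := (MulAction.toPermHom X (𝒜 →ₐ[K] K)).ker.inv_mem hy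
      rw [MonoidHom.mem_ker] at this
      exact congrArg (fun e : Equiv.Perm _ => e (ψ i)) this
    have h2 := congrArg (fun φ : 𝒜 →ₐ[K] K =>
      φ ⟨(ρ a).val, Algebra.subset_adjoin ⟨a, ha, rfl⟩⟩) h1
    simp only [smul_apply, inv_inv] at h2
    rw [map_mul, map_mul]
    exact h2

end Matrices

/-! ### Supplements, the `p`-core and power subgroups -/

section GroupTheory

variable {G Q : Type*} [Group G] [Group Q]

/-- A normal subgroup `P` of a finite group has a subgroup of `p`-power order and index prime to
`p` whose normalizer contains a supplement `X` of `P` with `X ⊓ P` solvable. -/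
theorem exists_supplement_normalizing_sylow [Finite G] (p : ℕ) [Fact p.Prime] (P : Subgroup G)
    [P.Normal] :
    ∃ S X : Subgroup G, IsPGroup p S ∧ S ≤ P ∧ ¬ p ∣ S.relIndex P ∧
      X ≤ Subgroup.normalizer (S : Set G) ∧ X ⊔ P = ⊤ ∧
      Group.IsSolvable (X ⊓ P : Subgroup G) := by
  let T : Sylow p P := default
  let S : Subgroup G := T.map P.subtype
  have hSP : S ≤ P := Subgroup.map_subtype_le _
  have hrel : S.relIndex P = T.index := by
    rw [Subgroup.relIndex]
    congr 1
    exact Subgroup.comap_map_eq_self_of_injective P.subtype_injective _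
  -- A minimal supplement of `P` in the normalizer of `S`; the normalizer is one by the Frattini
  -- argument.
  obtain ⟨X, ⟨hXS, hXP⟩, hmin⟩ := WellFounded.has_min (wellFounded_lt (α := Subgroup G))
    {X | X ≤ Subgroup.normalizer (S : Set G) ∧ X ⊔ P = ⊤}
    ⟨_, le_rfl, T.normalizer_sup_eq_top⟩
  refine ⟨S, X, T.isPGroup'.map _, hSP, hrel ▸ T.not_dvd_index, hXS, hXP, ?_⟩
  -- A maximal subgroup of `X` not containing `X ⊓ P` would be a smaller supplement.
  have hfr : P.subgroupOf X ≤ frattini X := by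
    refine le_iInf₂ fun M hM => ?_
    by_contra hn
    have htop : M ⊔ P.subgroupOf X = ⊤ := hM.2 _ (left_lt_sup.2 hn)
    refine hmin (M.map X.subtype) ⟨(Subgroup.map_subtype_le M).trans hXS, ?_⟩ ?_
    · have h1 := congrArg (Subgroup.map X.subtype) htop
      rw [Subgroup.map_sup, Subgroup.subgroupOf_map_subtype, ← MonoidHom.range_eq_map,
        Subgroup.range_subtype] at h1
      rw [← top_le_iff, ← hXP]
      refine sup_le ?_ le_sup_right
      exact h1.ge.trans (sup_le_sup_left inf_le_left _)
    · refine lt_of_le_of_ne (Subgroup.map_subtype_le M) fun h => hM.1 ?_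
      apply Subgroup.map_injective X.subtype_injective
      rw [h, ← MonoidHom.range_eq_map, Subgroup.range_subtype]
  have : Group.IsNilpotent (frattini X) := frattini_nilpotent
  let ι : (X ⊓ P : Subgroup G) →* frattini X :=
    (Subgroup.inclusion inf_le_left : (X ⊓ P : Subgroup G) →* X).codRestrict _
      fun x => hfr (Subgroup.mem_subgroupOf.2 x.2.2)
  refine Group.isSolvable_of_isSolvable_injective (f := ι) fun a b h => ?_
  exact Subtype.ext (congrArg (fun z : frattini X => ((z : X) : G)) h)

/-- The version of `exists_supplement_normalizing_sylow` inside a subgroup `R`. -/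
theorem exists_supplement_normalizing_sylow_of_le [Finite G] (p : ℕ) [Fact p.Prime]
    (P R : Subgroup G) (hPR : P ≤ R) (hR : R ≤ Subgroup.normalizer (P : Set G)) :
    ∃ S X : Subgroup G, IsPGroup p S ∧ S ≤ P ∧ ¬ p ∣ S.relIndex P ∧ X ≤ R ∧
      X ≤ Subgroup.normalizer (S : Set G) ∧ (∀ r ∈ R, ∃ x ∈ X, x⁻¹ * r ∈ P) ∧
      Group.IsSolvable (X ⊓ P : Subgroup G) := by
  have hn : (P.subgroupOf R).Normal := (Subgroup.normal_subgroupOf_iff_le_normalizer hPR).2 hR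
  obtain ⟨S, X, hS, hSP, hrel, hXS, hXP, hsol⟩ :=
    exists_supplement_normalizing_sylow p (P.subgroupOf R)
  have hPm : (P.subgroupOf R).map R.subtype = P := by
    rw [Subgroup.subgroupOf_map_subtype, inf_of_le_left hPR]
  have hrel' : (S.map R.subtype).relIndex P = S.relIndex (P.subgroupOf R) := by
    conv_lhs => rw [← hPm]
    exact Subgroup.relIndex_map_map_of_injective _ _ R.subtype_injective
  refine ⟨S.map R.subtype, X.map R.subtype, hS.map _, ?_, ?_, Subgroup.map_subtype_le X, ?_, ?_, ?_⟩
  · rw [← hPm]; exact Subgroup.map_mono hSP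
  · rwa [hrel']
  · exact (Subgroup.map_mono hXS).trans (Subgroup.le_normalizer_map R.subtype)
  · intro r hr
    have : (⟨r, hr⟩ : R) ∈ X ⊔ P.subgroupOf R := hXP ▸ Subgroup.mem_top _
    obtain ⟨x, hx, y, hy, hxy⟩ := Subgroup.mem_sup_of_normal_right.1 this
    refine ⟨x, Subgroup.mem_map_of_mem _ hx, ?_⟩
    have h1 : r = x * y := (congrArg Subtype.val hxy).symm
    rw [h1, inv_mul_cancel_left]
    exact hy
  · have h1 : X.map R.subtype ⊓ P = (X ⊓ P.subgroupOf R).map R.subtype := by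
      rw [Subgroup.map_inf_eq _ _ _ R.subtype_injective, hPm]
    rw [h1]
    exact Group.isSolvable_of_surjective
      (f := ((X ⊓ P.subgroupOf R).equivMapOfInjective R.subtype R.subtype_injective).toMonoidHom)
      (MulEquiv.surjective _)

theorem le_pCore {p : ℕ} {H : Subgroup G} (hn : H.Normal) (hp : IsPGroup p H) : H ≤ pCore p G :=
  le_sSup ⟨hn, hp⟩

/-- Sylow subgroups are conjugate, so every normal `p`-subgroup lies in a fixed one, and hence so
does their join. -/
theorem isPGroup_pCore [Finite G] (p : ℕ) [Fact p.Prime] : IsPGroup p (pCore p G) := by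
  let T : Sylow p G := default
  refine T.isPGroup'.to_le (sSup_le ?_)
  rintro H ⟨hn, hp⟩
  obtain ⟨T', hT'⟩ := hp.exists_le_sylow
  obtain ⟨g, hg⟩ := MulAction.exists_smul_eq G T' T
  rw [← hg]
  intro x hx
  have h1 : g⁻¹ * x * g ∈ T' := hT' (by simpa using hn.conj_mem x hx g⁻¹)
  have h2 := Subgroup.smul_mem_pointwise_smul _ (MulAut.conj g) T'.toSubgroup h1
  have h3 : MulAut.conj g • (g⁻¹ * x * g) = x := by simp [mul_assoc]
  rw [h3] at h2
  exact h2

instance pCore_characteristic (p : ℕ) : (pCore p G).Characteristic := by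
  refine Subgroup.characteristic_iff_map_le.2 fun φ => ?_
  rw [Subgroup.map_le_iff_le_comap]
  refine sSup_le ?_
  rintro H ⟨hn, hp⟩
  rw [← Subgroup.map_le_iff_le_comap]
  exact le_pCore (hn.map _ φ.surjective) (hp.map _)

/-- The preimage of the `p`-core of the quotient is an extension of a `p`-group by a `p`-group, and
normal. -/
theorem pCore_quotient_pCore [Finite G] (p : ℕ) [Fact p.Prime] :
    pCore p (G ⧸ pCore p G) = ⊥ := by
  rw [eq_bot_iff]
  intro q hq
  obtain ⟨g, rfl⟩ := QuotientGroup.mk'_surjective (pCore p G) q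
  have hp : IsPGroup p ((pCore p (G ⧸ pCore p G)).comap (QuotientGroup.mk' (pCore p G))) :=
    (isPGroup_pCore p).comap_of_ker_isPGroup _
      (by rw [QuotientGroup.ker_mk']; exact isPGroup_pCore p)
  have h1 : g ∈ pCore p G := le_pCore inferInstance hp hq
  exact Subgroup.mem_bot.2 ((QuotientGroup.eq_one_iff g).2 h1)

/-- A normal `p`-subgroup of a normal subgroup is killed by every surjection onto a group without
nontrivial normal `p`-subgroups. -/
theorem map_eq_one_of_mem_isPGroup {p : ℕ} [Fact p.Prime] [Finite G] {θ : G →* Q}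
    (hθ : Function.Surjective θ) (hQ : pCore p Q = ⊥) {U : Subgroup G} [U.Normal] {W : Subgroup U}
    (hn : W.Normal) (hW : IsPGroup p W) {w : U} (hw : w ∈ W) : θ w = 1 := by
  -- `W` need not be normal in `G`, but it lies in the `p`-core of `U`, which is characteristic in
  -- `U` and so normal in `G`.
  have h1 : ((pCore p U).map U.subtype).map θ ≤ pCore p Q :=
    le_pCore (Subgroup.Normal.map inferInstance _ hθ) (((isPGroup_pCore p).map _).map _)
  rw [hQ] at h1
  exact h1 (Subgroup.mem_map_of_mem _ (Subgroup.mem_map_of_mem _ (le_pCore hn hW hw)))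

/-- The subgroup generated by the `m`-th powers. -/
def powSubgroup (m : ℕ) (G : Type*) [Group G] : Subgroup G :=
  Subgroup.closure (Set.range fun g : G => g ^ m)

theorem pow_mem_powSubgroup (m : ℕ) (g : G) : g ^ m ∈ powSubgroup m G :=
  Subgroup.subset_closure ⟨g, rfl⟩

theorem powSubgroup_map (m : ℕ) {θ : G →* Q} (hθ : Function.Surjective θ) :
    (powSubgroup m G).map θ = powSubgroup m Q := by
  rw [powSubgroup, powSubgroup, MonoidHom.map_closure, ← Set.range_comp]
  congr 1
  ext q
  constructor
  · rintro ⟨g, rfl⟩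
    exact ⟨θ g, (map_pow θ g m).symm⟩
  · rintro ⟨q, rfl⟩
    obtain ⟨g, rfl⟩ := hθ q
    exact ⟨g, map_pow θ g m⟩

instance powSubgroup_characteristic (m : ℕ) : (powSubgroup m G).Characteristic :=
  Subgroup.characteristic_iff_map_le.2 fun φ => (powSubgroup_map m φ.surjective).le

theorem powSubgroup_le {m : ℕ} (U : Subgroup G) [U.Normal] (h : U.index ∣ m) :
    powSubgroup m G ≤ U := by
  rw [powSubgroup, Subgroup.closure_le]
  rintro _ ⟨g, rfl⟩
  obtain ⟨k, rfl⟩ := h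
  simp only [pow_mul]
  exact U.pow_mem (U.pow_index_mem g) k

/-- In a finite subgroup of `(Kˣ) ^ n` the `m`-th powers have index at most `m ^ n`. -/
theorem index_range_powMonoidHom_le {K : Type*} [Field K] {n m : ℕ} (hm : 0 < m)
    (A : Subgroup (Fin n → Kˣ)) [Finite A] : (powMonoidHom m : A →* A).range.index ≤ m ^ n := by
  have : NeZero m := ⟨hm.ne'⟩
  -- In a finite group the image of the power map has index equal to the order of its kernel, here
  -- made of `n`-tuples of `m`-th roots of unity.
  rw [Subgroup.index_range]
  let f : (powMonoidHom m : A →* A).ker → Fin n → rootsOfUnity m K := fun a i =>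
    ⟨(a : A).1 i, by
      have h1 : ((a : A)) ^ m = 1 := a.2
      exact (mem_rootsOfUnity _ _).2 (congrFun (congrArg Subtype.val h1) i)⟩
  have hf : Function.Injective f := fun a b h => by
    apply Subtype.ext
    apply Subtype.ext
    funext i
    exact congrArg Subtype.val (congrFun h i)
  refine (Nat.card_le_card_of_injective f hf).trans ?_
  rw [Nat.card_fun, Nat.card_fin]
  exact Nat.pow_le_pow_left (card_rootsOfUnity K m) n

/-- On `U` the map `θ` factors through the finite group `δ(U)`, whose `m`-th powers land in the
`m`-th powers of `Q`; passing from `U` to `G` costs `U.index`. -/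
theorem index_powSubgroup_le {K : Type*} [Field K] [Finite G] {n m : ℕ} (hm : 0 < m)
    {θ : G →* Q} (hθ : Function.Surjective θ) (U : Subgroup G) (δ : U →* (Fin n → Kˣ))
    (hδ : ∀ u ∈ δ.ker, θ u = 1) : (powSubgroup m Q).index ≤ U.index * m ^ n := by
  let M : Subgroup U := (powSubgroup m Q).comap (θ.comp U.subtype)
  have hM : M.index ≤ m ^ n := by
    have hker : δ.rangeRestrict.ker ≤ M := fun u hu => by
      rw [MonoidHom.ker_rangeRestrict] at hu
      change θ u ∈ powSubgroup m Q
      rw [hδ u hu]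
      exact one_mem _
    rw [← Subgroup.index_map_eq M δ.rangeRestrict_surjective hker]
    have hle : (powMonoidHom m : δ.range →* δ.range).range ≤ M.map δ.rangeRestrict := by
      rintro _ ⟨a, rfl⟩
      obtain ⟨u, rfl⟩ := δ.rangeRestrict_surjective a
      refine ⟨u ^ m, ?_, map_pow _ _ _⟩
      change θ ((u ^ m : U) : G) ∈ powSubgroup m Q
      rw [Subgroup.coe_pow, map_pow]
      exact pow_mem_powSubgroup m _
    have : Finite δ.range := Finite.of_surjective _ δ.rangeRestrict_surjective
    exact (Nat.le_of_dvd (Nat.pos_of_ne_zero Subgroup.index_ne_zero_of_finite)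
      (Subgroup.index_dvd_of_le hle)).trans (index_range_powMonoidHom_le hm _)
  rw [← Subgroup.index_comap_of_surjective _ hθ]
  have hle : M.map U.subtype ≤ (powSubgroup m Q).comap θ := by
    rintro _ ⟨u, hu, rfl⟩
    exact hu
  refine (Nat.le_of_dvd (Nat.pos_of_ne_zero Subgroup.index_ne_zero_of_finite)
    (Subgroup.index_dvd_of_le hle)).trans ?_
  rw [Subgroup.index_map_subtype, mul_comm]
  exact Nat.mul_le_mul_left _ hM

theorem index_normalCore_le (H : Subgroup G) (h : H.index ≠ 0) :
    H.normalCore.index ≤ H.index.factorial := by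
  have : Finite (G ⧸ H) := Nat.finite_of_card_ne_zero h
  rw [Subgroup.normalCore_eq_ker, Subgroup.index_ker, Subgroup.index_eq_card, ← Nat.card_perm]
  exact Subgroup.card_le_card_group _

end GroupTheory

/-! ### Sections of a group -/

section Sections

variable {G : Type*} [Group G] (H N : Subgroup G) [(N.subgroupOf H).Normal]

theorem mem_sectionPreimage {L : Subgroup (SectionQuot H N)} {g : G} :
    g ∈ sectionPreimage H N L ↔
      ∃ h : g ∈ H, (QuotientGroup.mk (⟨g, h⟩ : H) : SectionQuot H N) ∈ L := by
  constructor
  · rintro ⟨h, hh, rfl⟩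
    exact ⟨h.2, hh⟩
  · rintro ⟨h, hh⟩
    exact ⟨⟨g, h⟩, hh, rfl⟩

theorem sectionPreimage_le (L : Subgroup (SectionQuot H N)) : sectionPreimage H N L ≤ H :=
  Subgroup.map_subtype_le _

theorem le_sectionPreimage (hNH : N ≤ H) (L : Subgroup (SectionQuot H N)) :
    N ≤ sectionPreimage H N L := fun g hg => by
  refine (mem_sectionPreimage H N).2 ⟨hNH hg, ?_⟩
  rw [(QuotientGroup.eq_one_iff _).2 (Subgroup.mem_subgroupOf.2 hg)]
  exact one_mem _

theorem le_sectionNormalizer (hNH : N ≤ H) : H ≤ sectionNormalizer H N :=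
  le_inf Subgroup.le_normalizer ((Subgroup.normal_subgroupOf_iff_le_normalizer hNH).1 inferInstance)

/-- Each element of the normalizer induces an automorphism of `H / N`, and a characteristic `L` is
stable under it. -/
theorem sectionNormalizer_le_normalizer_sectionPreimage (L : Subgroup (SectionQuot H N))
    [hL : L.Characteristic] :
    sectionNormalizer H N ≤ Subgroup.normalizer (sectionPreimage H N L : Set G) := by
  have key : ∀ r ∈ sectionNormalizer H N, ∀ g ∈ sectionPreimage H N L,
      r * g * r⁻¹ ∈ sectionPreimage H N L := by
    intro r hr g hg
    obtain ⟨hgH, hgL⟩ := (mem_sectionPreimage H N).1 hg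
    let e : H ≃* H := H.normalizerMonoidHom ⟨r, hr.1⟩
    have he : ∀ h : H, (e h : G) = r * h * r⁻¹ := fun h => rfl
    have hmap : (N.subgroupOf H).map (e : H →* H) = N.subgroupOf H := by
      ext h
      constructor
      · rintro ⟨k, hk, rfl⟩
        exact (Subgroup.mem_normalizer_iff.1 hr.2 k).1 hk
      · intro hh
        refine ⟨e.symm h, ?_, e.apply_symm_apply h⟩
        refine (Subgroup.mem_normalizer_iff.1 hr.2 _).2 ?_
        change r * ((e.symm h : H) : G) * r⁻¹ ∈ N
        rw [← he, e.apply_symm_apply]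
        exact hh
    let ē := QuotientGroup.congr (N.subgroupOf H) (N.subgroupOf H) e hmap
    have h1 : ē (QuotientGroup.mk ⟨g, hgH⟩) ∈ L := by
      have := Subgroup.characteristic_iff_le_comap.1 hL ē
      exact this hgL
    exact (mem_sectionPreimage H N).2 ⟨(e ⟨g, hgH⟩).2, h1⟩
  intro r hr
  refine Subgroup.mem_normalizer_iff.2 fun g => ⟨key r hr g, fun hg => ?_⟩
  have := key r⁻¹ (inv_mem hr) _ hg
  simpa [mul_assoc] using this

/-- If `L` is a `p`-group then so is the section `sectionPreimage H N L / N`. -/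
theorem exists_relIndex_sectionPreimage_eq_pow {p : ℕ} [Fact p.Prime] [Finite G] (hNH : N ≤ H)
    (L : Subgroup (SectionQuot H N)) (hL : IsPGroup p L) :
    ∃ k, N.relIndex (sectionPreimage H N L) = p ^ k := by
  obtain ⟨k, hk⟩ := IsPGroup.iff_card.1 hL
  refine ⟨k, ?_⟩
  rw [← hk]
  have h1 : (N.subgroupOf H).map H.subtype = N := by
    rw [Subgroup.subgroupOf_map_subtype, inf_of_le_left hNH]
  have h2 : N.subgroupOf H = (⊥ : Subgroup (SectionQuot H N)).comap
      (QuotientGroup.mk' (N.subgroupOf H)) := by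
    rw [MonoidHom.comap_bot, QuotientGroup.ker_mk']
  calc N.relIndex (sectionPreimage H N L)
      = ((N.subgroupOf H).map H.subtype).relIndex (sectionPreimage H N L) := by rw [h1]
    _ = (N.subgroupOf H).relIndex (L.comap (QuotientGroup.mk' (N.subgroupOf H))) :=
        Subgroup.relIndex_map_map_of_injective _ _ H.subtype_injective
    _ = ((⊥ : Subgroup (SectionQuot H N)).comap (QuotientGroup.mk' (N.subgroupOf H))).relIndex
          (L.comap (QuotientGroup.mk' (N.subgroupOf H))) := by rw [← h2]
    _ = Nat.card L := by
        rw [Subgroup.relIndex_comap, Subgroup.map_comap_eq_self_of_surjective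
          (QuotientGroup.mk'_surjective _), Subgroup.relIndex_bot_left]

end Sections

/-! ### Assembly of the theorem -/

/-- Mal'cev's theorem in matrix form: a solvable linear group over an algebraically closed
field has a normal subgroup of bounded index that can be conjugated to upper triangular form. -/
theorem exists_normal_isTrigonalizable {K : Type*} [Field K] [IsAlgClosed K] {n : ℕ} {D : Type*}
    [Group D] [Group.IsSolvable D] (ρ : D →* Matrix.GeneralLinearGroup (Fin n) K) :
    ∃ U : Subgroup D, U.Normal ∧ U.index ≠ 0 ∧ U.index ≤ (malcevBound n).factorial ∧
      Representation.IsTrigonalizable (V := Fin n → K)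
        ((Matrix.GeneralLinearGroup.stdRepresentation n K).comp (ρ.comp U.subtype)) := by
  obtain ⟨H, hH0, hH, hHt⟩ := Representation.exists_isTrigonalizable_of_isSolvable (K := K) n
    (V := Fin n → K) ((Matrix.GeneralLinearGroup.stdRepresentation n K).comp ρ) (by simp)
  have : H.FiniteIndex := ⟨hH0⟩
  exact ⟨H.normalCore, inferInstance, Subgroup.FiniteIndex.index_ne_zero,
    (index_normalCore_le H hH0).trans (Nat.factorial_le hH),
    hHt.comp (Subgroup.inclusion H.normalCore_le)⟩

/-- If `L / N` is a `p`-group, a subgroup of `L` of index prime to `p` maps onto it. -/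
theorem exists_mul_eq_of_relIndex {G : Type*} [Group G] [Finite G] {p k : ℕ} [Fact p.Prime]
    {S N L : Subgroup G} (hS : ¬ p ∣ S.relIndex L) (hN : N.relIndex L = p ^ k)
    (hL : L ≤ Subgroup.normalizer (N : Set G)) (hSL : S ≤ L) {y : G} (hy : y ∈ L) :
    ∃ s ∈ S, s⁻¹ * y ∈ N := by
  -- The index of `S N` in `L` is both prime to `p` and a power of `p`.
  have h1 : (S ⊔ N).relIndex L ∣ S.relIndex L := Subgroup.relIndex_dvd_of_le_left L le_sup_left
  have h2 : (S ⊔ N).relIndex L ∣ p ^ k := hN ▸ Subgroup.relIndex_dvd_of_le_left L le_sup_right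
  have h3 : (S ⊔ N).relIndex L = 1 := by
    obtain ⟨j, -, hj⟩ := (Nat.dvd_prime_pow (Fact.out : p.Prime)).1 h2
    rcases Nat.eq_zero_or_pos j with rfl | hj0
    · simpa using hj
    · exact absurd ((dvd_pow_self p hj0.ne').trans (hj ▸ h1)) hS
  have h4 : y ∈ S ⊔ N := Subgroup.relIndex_eq_one.1 h3 hy
  rw [← SetLike.mem_coe, Subgroup.coe_mul_of_left_le_normalizer_right S N (hSL.trans hL)] at h4
  obtain ⟨s, hs, t, ht, rfl⟩ := Set.mem_mul.1 h4
  exact ⟨s, hs, by simpa using ht⟩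

/-- The index of the centralizer of a section `H / P` in a group `R` that normalizes it is bounded by
the index, in a supplement `X` of `P` in `R`, of a subgroup that acts trivially modulo `P` on a
supplement `A` of `P` in `H`. -/
theorem relIndex_sectionCentralizer_le {G : Type*} [Group G] [Finite G] {H P R X : Subgroup G}
    (hPH : P ≤ H) (hRH : R ≤ Subgroup.normalizer (H : Set G))
    (hRP : R ≤ Subgroup.normalizer (P : Set G)) (hHR : H ≤ R) (hXR : X ≤ R)
    (hX : ∀ r ∈ R, ∃ x ∈ X, x⁻¹ * r ∈ P) {A : Subgroup G} (hA : ∀ h ∈ H, ∃ v ∈ A, v⁻¹ * h ∈ P)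
    (Y : Subgroup X) (hY : ∀ y ∈ Y, ∀ v ∈ A, v⁻¹ * (y * v * (y : G)⁻¹) ∈ P) :
    (sectionCentralizer H P).relIndex R ≤ Y.index := by
  have hYC : ∀ y ∈ Y, (y : G) ∈ sectionCentralizer H P := fun y hy =>
    ⟨⟨hRH (hXR y.2), hRP (hXR y.2)⟩, fun h hh => by
      obtain ⟨v, hv, hvh⟩ := hA h hh
      have h2 := (Subgroup.mem_normalizer_iff.1 (hRP (hXR y.2)) _).1 hvh
      have h3 := mul_mem (mul_mem (inv_mem hvh) (hY y hy v hv)) h2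
      convert h3 using 1
      group⟩
  -- `P` acts trivially on `H / P`, so the cosets of the centralizer in `R` are already represented
  -- in `X`.
  have hPC : P ≤ sectionCentralizer H P := fun y hy =>
    ⟨⟨hRH (hHR (hPH hy)), hRP (hHR (hPH hy))⟩, fun h hh => by
      have h1 := (Subgroup.mem_normalizer_iff.1 (hRP (hHR (inv_mem hh))) y).1 hy
      have := mul_mem h1 (inv_mem hy)
      simpa [mul_assoc] using this⟩
  let f : X ⧸ Y → R ⧸ (sectionCentralizer H P).subgroupOf R :=
    Quotient.map' (Subgroup.inclusion hXR) fun a b hab => by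
      rw [QuotientGroup.leftRel_apply] at hab ⊢
      exact hYC _ hab
  have hf : Function.Surjective f := by
    intro q
    obtain ⟨r, rfl⟩ := QuotientGroup.mk_surjective q
    obtain ⟨x, hx, hxr⟩ := hX r r.2
    refine ⟨QuotientGroup.mk ⟨x, hx⟩, ?_⟩
    exact QuotientGroup.eq.2 (hPC hxr)
  exact Nat.card_le_card_of_surjective f hf

/-- The exponent `m` such that the `m`-th powers, together with the `p`-core, generate the
characteristic subgroup of `mainTheorem6`. -/
def trigonalizableExponent (n : ℕ) : ℕ := (malcevBound n).factorial.factorial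

/-- The bound for the index of the characteristic subgroup of `mainTheorem6`. -/
def trigonalizableBound (n : ℕ) : ℕ := (malcevBound n).factorial * trigonalizableExponent n ^ n

theorem mainTheorem6 :
    ∃ C : ℕ → ℕ, ∀ (n p : ℕ) (F : Type u) [Field F] [Finite F] [CharP F p]
      (Γ N : Subgroup (Matrix.GeneralLinearGroup (Fin n) F)) [(N.subgroupOf Γ).Normal],
      N ≤ Γ → Group.IsSolvable (SectionQuot Γ N) →
      ∃ S₀ : Subgroup (SectionQuot Γ N),
        S₀.Characteristic ∧
        IsTrigonalizableSection (sectionPreimage Γ N S₀) N ∧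
        S₀.index ≤ C n ∧
        pCore p (SectionQuot Γ N) ≤ S₀ ∧
        (sectionCentralizer (sectionPreimage Γ N S₀)
            (sectionPreimage Γ N (pCore p (SectionQuot Γ N)))).relIndex
          (sectionNormalizer Γ N) ≤ n.factorial := by
  refine ⟨trigonalizableBound, fun n p F _ _ _ Γ N _ hNΓ hsol => ?_⟩
  have hp : Fact p.Prime := ⟨CharP.char_is_prime F p⟩
  let G := Matrix.GeneralLinearGroup (Fin n) F
  let K := AlgebraicClosure F
  have hK : CharP K p := charP_of_injective_algebraMap (algebraMap F K).injective p
  have hKinf : Infinite K := IsAlgClosed.instInfinite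
  -- The inner factorial bounds the index of a normal core, and the outer one is divisible by every
  -- index up to that bound.
  let m := trigonalizableExponent n
  let O := pCore p (SectionQuot Γ N)
  let S₀ : Subgroup (SectionQuot Γ N) := O ⊔ powSubgroup m (SectionQuot Γ N)
  have hS₀ : S₀.Characteristic := inferInstance
  let P := sectionPreimage Γ N O
  let Γ₀ := sectionPreimage Γ N S₀
  let R := sectionNormalizer Γ N
  have hPΓ : P ≤ Γ := sectionPreimage_le Γ N O
  have hΓR : Γ ≤ R := le_sectionNormalizer Γ N hNΓ
  have hRP : R ≤ Subgroup.normalizer (P : Set G) :=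
    sectionNormalizer_le_normalizer_sectionPreimage Γ N O
  have hPΓ₀ : P ≤ Γ₀ := fun g hg => by
    obtain ⟨h1, h2⟩ := (mem_sectionPreimage Γ N).1 hg
    exact (mem_sectionPreimage Γ N).2 ⟨h1, le_sup_left (a := O) h2⟩
  obtain ⟨S, X, hS, hSP, hSrel, hXR, hXS, hX, hXsol⟩ :=
    exists_supplement_normalizing_sylow_of_le p P R (hPΓ.trans hΓR) hRP
  -- `D` is a solvable group mapping onto `Σ / O_p(Σ)`
  let D : Subgroup G := X ⊓ Γ
  let Q := SectionQuot Γ N ⧸ O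
  let π : Γ →* Q := (QuotientGroup.mk' O).comp (QuotientGroup.mk' (N.subgroupOf Γ))
  have hπ : Function.Surjective π :=
    (QuotientGroup.mk'_surjective O).comp (QuotientGroup.mk'_surjective _)
  have hπP : ∀ g : Γ, π g = 1 ↔ (g : G) ∈ P := fun g => by
    rw [mem_sectionPreimage Γ N]
    exact (QuotientGroup.eq_one_iff _).trans ⟨fun h => ⟨g.2, h⟩, fun ⟨_, h⟩ => h⟩
  let θ : D →* Q := π.comp (Subgroup.inclusion inf_le_right)
  have hθ : Function.Surjective θ := by
    intro q
    obtain ⟨g, rfl⟩ := hπ q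
    obtain ⟨x, hx, hxg⟩ := hX g (hΓR g.2)
    have hxΓ : x ∈ Γ := by
      have := mul_mem g.2 (inv_mem (hPΓ hxg))
      simpa using this
    refine ⟨⟨x, hx, hxΓ⟩, ?_⟩
    have h1 : π (⟨x, hxΓ⟩⁻¹ * g) = 1 := (hπP _).2 hxg
    rw [map_mul, map_inv, inv_mul_eq_one] at h1
    exact h1
  have hQ : pCore p Q = ⊥ := pCore_quotient_pCore p
  -- The kernel of `θ` is `X ⊓ P`, soluble by the choice of `X`, and `Q` is a quotient of the
  -- soluble `Σ`.
  have hDsol : Group.IsSolvable D :=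
    Group.isSolvable_of_ker_le_range (Subgroup.inclusion (inf_le_inf_left X hPΓ)) θ fun d hd =>
      ⟨⟨d, d.2.1, (hπP _).1 hd⟩, rfl⟩
  let ρ : G →* Matrix.GeneralLinearGroup (Fin n) K :=
    Matrix.GeneralLinearGroup.map (algebraMap F K)
  have hρ : Function.Injective ρ := by
    intro a b h
    apply Units.ext
    ext i j
    have := congrArg (fun M : Matrix.GeneralLinearGroup (Fin n) K => M.val i j) h
    exact (algebraMap F K).injective this
  obtain ⟨U, hUn, hU0, hU, hUt⟩ := exists_normal_isTrigonalizable (ρ.comp D.subtype)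
  obtain ⟨x, hx⟩ := exists_conj_blockTriangular _ hUt
  -- The conjugation that makes `U` triangular is applied to all of `G`, so that `X` acts on the
  -- same matrices.
  let σ : G →* Matrix.GeneralLinearGroup (Fin n) K := (MulAut.conj x).toMonoidHom.comp ρ
  have hσ : Function.Injective σ := (MulAut.conj x).injective.comp hρ
  let σU : U →* Matrix.GeneralLinearGroup (Fin n) K := σ.comp (D.subtype.comp U.subtype)
  have hσU : ∀ u, (σU u).val.IsUpperTriangular := hx
  have hδp := isPGroup_ker_diagUnitsHom (p := p) σU
    (hσ.comp (D.subtype_injective.comp U.subtype_injective)) hσU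
  have hδ : ∀ u ∈ (diagUnitsHom σU hσU).ker, θ u = 1 := fun u hu =>
    map_eq_one_of_mem_isPGroup hθ hQ inferInstance hδp hu
  have hm : 0 < m := Nat.factorial_pos _
  have hUm : U.index ∣ m := Nat.dvd_factorial (Nat.pos_of_ne_zero hU0) hU
  -- `V` is a trigonalizable group mapping onto `Σ₀ / O_p(Σ)`
  let V : Subgroup G := (powSubgroup m D).map D.subtype
  have hVU : ∀ v ∈ V, ∃ u : U, ((u : D) : G) = v := by
    rintro _ ⟨d, hd, rfl⟩
    exact ⟨⟨d, powSubgroup_le U hUm hd⟩, rfl⟩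
  have hXD : X ≤ Subgroup.normalizer (D : Set G) := by
    intro y hy
    refine Subgroup.mem_normalizer_iff.2 fun d => ?_
    have h1 := Subgroup.mem_normalizer_iff.1 (Subgroup.le_normalizer hy) d
    have h2 := Subgroup.mem_normalizer_iff.1 (hXR hy).1 d
    exact and_congr h1 h2
  have hXV : X ≤ Subgroup.normalizer (V : Set G) := by
    have key : ∀ y ∈ X, ∀ v ∈ V, y * v * y⁻¹ ∈ V := by
      rintro y hy _ ⟨d, hd, rfl⟩
      have h1 := Subgroup.characteristic_iff_le_comap.1
        (inferInstance : (powSubgroup m D).Characteristic) (D.normalizerMonoidHom ⟨y, hXD hy⟩) hd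
      exact ⟨_, h1, rfl⟩
    intro y hy
    refine Subgroup.mem_normalizer_iff.2 fun v => ⟨key y hy v, fun hv => ?_⟩
    have := key y⁻¹ (inv_mem hy) _ hv
    simpa [mul_assoc] using this
  have hS₀map : S₀.map (QuotientGroup.mk' O) = powSubgroup m Q := by
    rw [Subgroup.map_sup, powSubgroup_map m (QuotientGroup.mk'_surjective O),
      QuotientGroup.map_mk'_self, bot_sup_eq]
  have hcover : ∀ g ∈ Γ₀, ∃ v ∈ V, v⁻¹ * g ∈ P := by
    intro g hg
    obtain ⟨hgΓ, hgS⟩ := (mem_sectionPreimage Γ N).1 hg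
    have h1 : π ⟨g, hgΓ⟩ ∈ (powSubgroup m D).map θ := by
      rw [powSubgroup_map m hθ, ← hS₀map]
      exact Subgroup.mem_map_of_mem _ hgS
    obtain ⟨d, hd, hdg⟩ := h1
    refine ⟨d, Subgroup.mem_map_of_mem _ hd, (hπP (⟨d, d.2.2⟩⁻¹ * ⟨g, hgΓ⟩)).1 ?_⟩
    rw [map_mul, map_inv, inv_mul_eq_one]
    exact hdg
  have hVX : V ≤ X := (Subgroup.map_subtype_le _).trans inf_le_left
  refine ⟨S₀, hS₀, ?_, ?_, le_sup_left, ?_⟩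
  · have hVt : Representation.IsTrigonalizable (V := Fin n → K)
        (((Matrix.GeneralLinearGroup.stdRepresentation n K).comp ρ).comp V.subtype) := by
      have hVle : V ≤ U.map D.subtype := Subgroup.map_mono (powSubgroup_le U hUm)
      let e := U.equivMapOfInjective D.subtype D.subtype_injective
      have := hUt.comp (e.symm.toMonoidHom.comp (Subgroup.inclusion hVle))
      convert this using 1
      ext v : 1
      obtain ⟨u, hu⟩ := e.surjective (Subgroup.inclusion hVle v)
      have hv : (v : G) = ((u : D) : G) := (congrArg Subtype.val hu).symm
      simp only [MonoidHom.comp_apply, ← hu]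
      simp [hv]
    have hB := Representation.IsTrigonalizable.sup_of_isPGroup (p := p) _ S V hS
      (hVX.trans hXS) hVt
    obtain ⟨z, hz⟩ := exists_conj_blockTriangular (ρ.comp (S ⊔ V).subtype) hB
    refine ⟨S ⊔ V, ⟨K, inferInstance, inferInstance, z, fun b hb => hz ⟨b, hb⟩⟩, ?_⟩
    refine Set.eq_univ_of_forall fun q => ?_
    obtain ⟨g, rfl⟩ := QuotientGroup.mk_surjective q
    -- `V` covers `Γ₀` modulo `P`, and `S` covers `P` modulo `N`, so `v * s` represents `g` modulo
    -- `N`.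
    obtain ⟨v, hv, hvg⟩ := hcover g g.2
    obtain ⟨k, hk⟩ := exists_relIndex_sectionPreimage_eq_pow Γ N hNΓ O (isPGroup_pCore p)
    obtain ⟨s, hs, hsg⟩ := exists_mul_eq_of_relIndex hSrel hk
      ((hPΓ.trans hΓR).trans inf_le_right) hSP hvg
    have hb : (v * s)⁻¹ * g ∈ N := by simpa [mul_assoc] using hsg
    have hbΓ : v * s ∈ Γ₀ := by
      have := mul_mem g.2 (inv_mem (le_sectionPreimage Γ N hNΓ S₀ hb))
      simpa [mul_assoc] using this
    refine ⟨⟨v * s, hbΓ⟩, mul_mem (Subgroup.mem_sup_right hv) (Subgroup.mem_sup_left hs), ?_⟩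
    exact QuotientGroup.eq.2 hb
  · rw [← Subgroup.index_map_eq S₀ (QuotientGroup.mk'_surjective O)
      (by rw [QuotientGroup.ker_mk']; exact le_sup_left), hS₀map]
    exact (index_powSubgroup_le hm hθ U _ hδ).trans (Nat.mul_le_mul_right _ hU)
  · obtain ⟨Y, -, hY, hYV⟩ := exists_subgroup_fixing_diag σ V X hXV (by
      intro v hv
      obtain ⟨u, rfl⟩ := hVU v hv
      exact hσU u)
    refine (relIndex_sectionCentralizer_le hPΓ₀
      (sectionNormalizer_le_normalizer_sectionPreimage Γ N S₀) hRP
      ((sectionPreimage_le Γ N S₀).trans hΓR) hXR hX hcover Y ?_).trans hY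
    intro y hy v hv
    have hyv : (y : G) * v * (y : G)⁻¹ ∈ V := (Subgroup.mem_normalizer_iff.1 (hXV y.2) v).1 hv
    obtain ⟨u, hu⟩ := hVU v hv
    obtain ⟨w, hw⟩ := hVU _ hyv
    -- `v` and its conjugate by `y` have equal diagonals, so their quotient is unipotent in `U` and
    -- dies in `Q`.
    have hker : u⁻¹ * w ∈ (diagUnitsHom σU hσU).ker := by
      rw [MonoidHom.mem_ker, map_mul, map_inv, inv_mul_eq_one]
      funext i
      apply Units.ext
      have := hYV y hy v hv i
      rw [← hw, ← hu] at this
      exact this.symm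
    have := (hπP _).1 (hδ _ hker)
    rw [← hw, ← hu]
    exact this
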